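/- Let $\mathbb X$ be a complete separable metric space with its Borel $\sigma$-field, let $\eta$ be a probability measure on $\mathbb X$ and $\rho$ a $\sigma$-finite measure on $\mathbb R^+=(0,\infty)$, and suppose that the homogeneous intensity $\nu(dx,ds)=\eta(dx)\rho(ds)$ satisfies $\int_{A\times\mathbb R^+}\min\{y,s\}\,\nu(dx,dy)<\infty$ for every bounded Borel set $A$ and every $s>0$, and $\nu(\{x\}\times\mathbb R^+)=0$ for every $x\in\mathbb X$. Let $N$ be a Poisson process on $\mathbb X\times\mathbb R^+$ with intensity $\nu$, let $\widetilde\mu(A)=\int_{A\times\mathbb R^+}y\,N(dx,dy)$ be the associated completely random measure, and suppose that its total mass $\widetilde T=\widetilde\mu(\mathbb X)$ has a density $f_{\widetilde T}$ with respect to Lebesgue measure. Let $h$ be a positive Borel function on $\mathbb R^+$ with $E[h(\widetilde T)]<\infty$, and let $\widetilde\mu_t$ be a random measure on $\mathbb X$ with the tilted law $$\mathcal P_{\widetilde\mu_t}(d\mu)=\frac{h(\mu(\mathbb X))}{E[h(\widetilde\mu(\mathbb X))]}\,\mathcal P_{\widetilde\mu}(d\mu).$$ Put $\widetilde T_t=\widetilde\mu_t(\mathbb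 X)$ and $\widetilde G_t=\widetilde\mu_t/\widetilde T_t$. Given $\widetilde\mu_t$, let $X_1,\dots,X_n$ be independent with common distribution $\widetilde G_t$, and let $\mathbf p_n$ be the random partition of $\{1,\dots,n\}$ in which $i,j$ lie in the same cell if and only if $X_i=X_j$. For a Poisson process on $\mathbb R^+$ with intensity $\rho$, let $J_1\ge J_2\ge\cdots$ be its ranked points. Let $\mathrm{PK}(\rho\mid t)$ be the conditional law of $(J_k/\sum_iJ_i)_{k\ge1}$ given $\sum_iJ_i=t$, and for a probability measure $\gamma$ on $\mathbb R^+$ let $\mathrm{PK}(\rho,\gamma)=\int\mathrm{PK}(\rho\mid t)\,\gamma(dt)$. For a random sequence of masses $(W_k)$ with $\sum_kW_k=1$, the partition generated by $(W_k)$ is the partition of $\{1,\dots,n\}$ by equality of $I_1,\dots,I_n$, where, given $(W_k)$, the $I_j$ are independent with $P(I_j=k\mid (W_k))=W_k$. Then the following hold. 1. $\widetilde T_t$ has the density $f_{\widetilde T_t}(y)=h(y)f_{\widetilde T}(y)\big/\int_{\mathbb R^+}h(x)f_{\widetilde T}(x)\,dx$. 2. For almost every $t$ with respect to the law of $\widetilde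 T_t$, and every partition $p=\{C_1,\dots,C_K\}$ of $\{1,\dots,n\}$ with cell sizes $n_k=|C_k|$, the conditional probability that $\mathbf p_n=p$ given $\widetilde T_t=t$ is $$\mathbb P(p\mid t)=\int_{(\mathbb R^+)^{K}}\mathbb I_{\{t-\sum_{k=1}^{K}s_k>0\}}\,\frac{f_{\widetilde T}\bigl(t-\sum_{k=1}^{K}s_k\bigr)}{t^{n}f_{\widetilde T}(t)}\prod_{k=1}^{K}s_k^{n_k}\rho(ds_k),$$ and this is the probability that masses with law $\mathrm{PK}(\rho\mid t)$ generate $p$. 3. $\mathbf p_n$ is a Poisson–Kingman partition $(\rho,\gamma)$ with $\gamma(dt)=f_{\widetilde T_t}(t)\,dt$: it has the law of the partition generated by masses with law $\mathrm{PK}(\rho,\gamma)$. 4. $\widetilde G_t$ is a Poisson–Kingman process: it has the law of $\sum_kW_k\delta_{Z_k}$, where $(W_k)$ has law $\mathrm{PK}(\rho,\gamma)$ and is independent of the independent variables $Z_1,Z_2,\dots$ with law $\eta$. -/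

import Mathlib

open MeasureTheory ProbabilityTheory Set
open scoped ENNReal NNReal

/-- `N` is a Poisson random measure (Poisson point process) on `E` with intensity `ν`, defined on
the probability space `(Ω, P)`: the count of a set of finite intensity is Poisson distributed, and
the counts of pairwise disjoint sets are mutually independent. -/
structure IsPoissonProcess {Ω E : Type*} [MeasurableSpace Ω] [MeasurableSpace E]
    (N : Ω → Measure E) (ν : Measure E) (P : Measure Ω) : Prop where
  measurable : Measurable N
  poisson : ∀ A : Set E, MeasurableSet A → ν A ≠ ∞ →
    P.map (fun ω => N ω A) = (poissonMeasure (ν A).toNNReal).map (fun k : ℕ => (k : ℝ≥0∞))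
  indep : ∀ (k : ℕ) (A : Fin k → Set E), (∀ i, MeasurableSet (A i)) →
    Pairwise (fun i j => Disjoint (A i) (A j)) → iIndepFun (fun i ω => N ω (A i)) P

/-- The conditions on the intensity measure of a completely random measure without fixed atoms and
without drift. Measures on `X × (0, ∞)` are represented as measures on `X × ℝ` that vanish on
`X × (-∞, 0]`. -/
structure IsCRMIntensity {X : Type*} [MetricSpace X] [MeasurableSpace X]
    (ν : Measure (X × ℝ)) : Prop where
  support : ν (univ ×ˢ Iic 0) = 0
  boundedlyFinite : ∀ A : Set X, MeasurableSet A → Bornology.IsBounded A → ∀ s : ℝ, 0 < s →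
    ∫⁻ z in A ×ˢ univ, ENNReal.ofReal (min z.2 s) ∂ν < ∞
  noFixedAtom : ∀ x : X, ν ({x} ×ˢ univ) = 0

/-- The completely random measure `A ↦ ∫_{A × (0,∞)} y N(dx, dy)` (one realization). -/
noncomputable def crm {X : Type*} [MeasurableSpace X] (N : Measure (X × ℝ)) : Measure X :=
  (N.withDensity (fun z => ENNReal.ofReal z.2)).map Prod.fst

theorem crm_apply {X : Type*} [MeasurableSpace X] (N : Measure (X × ℝ)) {A : Set X}
    (hA : MeasurableSet A) :
    crm N A = ∫⁻ z in A ×ˢ univ, ENNReal.ofReal z.2 ∂N := by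
  have h : (Prod.fst ⁻¹' A : Set (X × ℝ)) = A ×ˢ univ := by ext; simp
  rw [crm, Measure.map_apply measurable_fst hA, h,
    withDensity_apply _ (hA.prod MeasurableSet.univ)]

theorem measurable_crm {X : Type*} [MeasurableSpace X] :
    Measurable (crm : Measure (X × ℝ) → Measure X) := by
  refine Measure.measurable_of_measurable_coe _ fun A hA => ?_
  simp_rw [crm_apply _ hA, ← lintegral_indicator (hA.prod MeasurableSet.univ)]
  exact Measure.measurable_lintegral
    ((ENNReal.measurable_ofReal.comp measurable_snd).indicator (hA.prod MeasurableSet.univ))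

/-- The total mass of a measure, as a real number. -/
noncomputable def mass {X : Type*} [MeasurableSpace X] (m : Measure X) : ℝ := (m univ).toReal

/-- The normalized measure `m / m(X)`. -/
noncomputable def normalized {X : Type*} [MeasurableSpace X] (m : Measure X) : Measure X :=
  (m univ)⁻¹ • m

/-- The law `Q` of a random measure, tilted by the function `h` of the total mass:
`A ↦ (∫ h(m(X)) Q(dm))⁻¹ ∫_A h(m(X)) Q(dm)`. -/
noncomputable def tiltedLaw {X : Type*} [MeasurableSpace X] (h : ℝ → ℝ)
    (Q : Measure (Measure X)) : Measure (Measure X) :=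
  (∫⁻ m, ENNReal.ofReal (h (mass m)) ∂Q)⁻¹ •
    Q.withDensity (fun m => ENNReal.ofReal (h (mass m)))

/-- The tilted density `y ↦ h(y) f(y) / ∫_{(0,∞)} h f`. -/
noncomputable def tiltedDensity (h : ℝ → ℝ) (f : ℝ → ℝ≥0∞) (y : ℝ) : ℝ≥0∞ :=
  ENNReal.ofReal (h y) * f y / ∫⁻ x in Ioi (0 : ℝ), ENNReal.ofReal (h x) * f x

/-- `Y 1, …, Y n` is a sample from the normalization of the random measure `μ`, which has law `Q`:
given `μ`, the `Y i` are independent with distribution `μ / μ(X)`. -/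
structure IsNormalizedSample {Ω X : Type*} [MeasurableSpace Ω] [MeasurableSpace X] {n : ℕ}
    (Q : Measure (Measure X)) (μ : Ω → Measure X) (Y : Fin n → Ω → X) (P : Measure Ω) : Prop where
  measurable_measure : Measurable μ
  measurable_sample : ∀ i, Measurable (Y i)
  law : P.map μ = Q
  joint : ∀ (A : Set (Measure X)) (B : Fin n → Set X), MeasurableSet A →
    (∀ i, MeasurableSet (B i)) →
    P {ω | μ ω ∈ A ∧ ∀ i, Y i ω ∈ B i} = ∫⁻ m in A, ∏ i, m (B i) / m univ ∂Q

/-- The partition of `{1, …, n}` generated by the ties among `y 1, …, y n`. -/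
noncomputable def tiePartition {α : Type*} {n : ℕ} (y : Fin n → α) :
    Finpartition (Finset.univ : Finset (Fin n)) :=
  @Finpartition.ofSetoid (Fin n) _ _ (Setoid.ker y) (Classical.decRel _)

theorem mem_part_tiePartition {α : Type*} {n : ℕ} (y : Fin n → α) (i j : Fin n) :
    j ∈ (tiePartition y).part i ↔ y i = y j :=
  @Finpartition.mem_part_ofSetoid_iff_rel (Fin n) _ i _ (Setoid.ker y) (Classical.decRel _) j

/-- Partitions of a finite set carry the discrete σ-algebra. -/
instance instMeasurableSpaceFinpartition {n : ℕ} :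
    MeasurableSpace (Finpartition (Finset.univ : Finset (Fin n))) := ⊤

instance instDiscreteMeasurableSpaceFinpartition {n : ℕ} :
    DiscreteMeasurableSpace (Finpartition (Finset.univ : Finset (Fin n))) := ⟨fun _ => trivial⟩

/-- The expression
`∫ 1{t - ∑ s_k > 0} f(t - ∑ s_k) / (t ^ n f(t)) ∏ s_k ^ {n_k} ρ(ds_k)`,
where `k` runs over the cells of the partition `p` and `n_k` is the size of the cell `k`. -/
noncomputable def partitionProbGivenMass {n : ℕ} (ρ : Measure ℝ) (f : ℝ → ℝ≥0∞)
    (p : Finpartition (Finset.univ : Finset (Fin n))) (t : ℝ) : ℝ≥0∞ :=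
  ∫⁻ s : p.parts → ℝ,
    {s : p.parts → ℝ | 0 < t - ∑ c, s c}.indicator
      (fun s => f (t - ∑ c, s c) / (ENNReal.ofReal t ^ n * f t) *
        ∏ c, ENNReal.ofReal (s c) ^ (c : Finset (Fin n)).card) s
    ∂(Measure.pi fun _ : p.parts => ρ)

/-- The `k`-th largest point (`k = 0` is the largest) of a point configuration `m` on `(0, ∞)`;
it is `0` if there are at most `k` points. -/
noncomputable def rankedPoint (m : Measure ℝ) (k : ℕ) : ℝ :=
  sInf {x : ℝ | 0 < x ∧ m (Ioi x) ≤ k}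

/-- The sum of the points of a point configuration on `(0, ∞)`. -/
noncomputable def pointSum (m : Measure ℝ) : ℝ := (∫⁻ s, ENNReal.ofReal s ∂m).toReal

/-- The Poisson–Kingman distributions `t ↦ PK(ρ | t)`, where `ρ` is the intensity of the Poisson
process `M` on `(0, ∞)`: the conditional law, given that the sum of the points is `t`, of the
sequence of the ranked points divided by their sum. -/
noncomputable def pkKernel {Ω : Type*} [MeasurableSpace Ω] (M : Ω → Measure ℝ) (P : Measure Ω)
    [IsFiniteMeasure P] : Kernel ℝ (ℕ → ℝ) :=
  condDistrib (fun ω k => rankedPoint (M ω) k / pointSum (M ω)) (fun ω => pointSum (M ω)) P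

/-- The probability that a sample of size `n` from a random discrete distribution on `ℕ` whose
sequence of masses has law `Q` generates the partition `p`. -/
noncomputable def massPartitionProb {n : ℕ} (Q : Measure (ℕ → ℝ))
    (p : Finpartition (Finset.univ : Finset (Fin n))) : ℝ≥0∞ :=
  ∫⁻ w, (Measure.pi fun _ : Fin n =>
      Measure.sum fun k : ℕ => ENNReal.ofReal (w k) • Measure.dirac k)
    {I : Fin n → ℕ | tiePartition I = p} ∂Q

/-- The law of the random measure `∑ W_k δ_{Z_k}`, where the sequence `W` has law `Q` and is
independent of the independent `Z_0, Z_1, …` with law `η`. -/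
noncomputable def speciesLaw {X : Type*} [MeasurableSpace X] (Q : Measure (ℕ → ℝ))
    (η : Measure X) : Measure (Measure X) :=
  (Q.prod (Measure.infinitePi fun _ : ℕ => η)).map
    (fun wz => Measure.sum fun k : ℕ => ENNReal.ofReal (wz.1 k) • Measure.dirac (wz.2 k))

/-! Let `J_1 ≥ J_2 ≥ ...` be the ranked points of a Poisson process with intensity `ρ`, with sum
`T`, and let the marks `Z_k` be independent with law `η`. The completely random measure has the law
of `∑ J_k δ_{Z_k}`, because both random measures have the Laplace functional `G ↦ exp (-∫∫ (1 - exp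
(-s G(x))) η(dx) ρ(ds))` (`IsPoissonProcess.map_crm`). A density of the total mass excludes an atom
at `0`, so `ρ` is infinite. Hence there are infinitely many points, and the absence of fixed atoms
makes `η` diffuse, so the `Z_k` are almost surely distinct.

The tilt is a weight that depends on `T` alone. It gives `T` the tilted density and changes neither
the conditional law of `(J_k / T)` given `T` nor the independent marks (`lintegral_tilt_mul`). This
yields the law of the total mass and that of the normalized measure. Since the `Z_k` are distinct,
ties in the sample are ties between the indices drawn, so the partition is generated by the masses
`J_k / T` (`measure_mass_tiePartition`).

For the explicit formula, the masses `J_k / T` generate `p` with probability `T^{-n}` times the sum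
of `∏ J_{k_c}^{n_c}` over families of distinct indices. The multivariate Mecke formula turns `E[φ(T)
∑ ∏ a_c(J_{k_c})]` into `∫ ∏ a_c(s_c) E[φ(T + ∑ s_c)] ∏ ρ(ds_c)`. Taking `φ(t) = 1_B(t) t^{-n}`,
inserting the density of `T` and varying `B` identifies the integrand for almost every `t`.

The Mecke formula is itself obtained from Laplace transforms. Marks falling in disjoint sets, one
set for each `c`, force the indices in a product of sums to be distinct, and the Laplace functional
factorizes over these sets. Inclusion-exclusion and monotone difference quotients pass from
exponentials of the sums to the sums. -/

/-! ### The exponential and the logarithm on `[0, ∞]`. -/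

/-- The function `x ↦ exp (-x)` on `[0, ∞]`, with value `0` at `∞`. -/
noncomputable def expNeg (x : ℝ≥0∞) : ℝ≥0∞ := EReal.exp (-(x : EReal))

/-- The function `x ↦ max 0 (-log x)` on `[0, ∞]`, with value `∞` at `0`. -/
noncomputable def negLog (x : ℝ≥0∞) : ℝ≥0∞ := (-(ENNReal.log x)).toENNReal

@[simp] theorem expNeg_zero : expNeg 0 = 1 := by simp [expNeg]

@[simp] theorem expNeg_top : expNeg ∞ = 0 := by simp [expNeg]

theorem expNeg_add (x y : ℝ≥0∞) : expNeg (x + y) = expNeg x * expNeg y := by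
  rw [expNeg, expNeg, expNeg, ← EReal.exp_add, EReal.coe_ennreal_add, EReal.neg_add,
    sub_eq_add_neg] <;> simp

theorem expNeg_strictAnti : StrictAnti expNeg := fun _ _ h => by
  simpa [expNeg] using h

theorem expNeg_antitone : Antitone expNeg := expNeg_strictAnti.antitone

theorem expNeg_le_one (x : ℝ≥0∞) : expNeg x ≤ 1 := by
  simpa using expNeg_antitone (zero_le (a := x))

theorem expNeg_ne_top (x : ℝ≥0∞) : expNeg x ≠ ∞ :=
  ((expNeg_le_one x).trans_lt ENNReal.one_lt_top).ne

theorem continuous_expNeg : Continuous expNeg :=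
  ENNReal.continuous_exp.comp (continuous_neg.comp continuous_coe_ennreal_ereal)

theorem measurable_expNeg : Measurable expNeg := continuous_expNeg.measurable

@[fun_prop]
theorem Measurable.expNeg {α : Type*} [MeasurableSpace α] {f : α → ℝ≥0∞} (hf : Measurable f) :
    Measurable fun x => expNeg (f x) := measurable_expNeg.comp hf

theorem expNeg_ofReal {x : ℝ} (hx : 0 ≤ x) :
    expNeg (ENNReal.ofReal x) = ENNReal.ofReal (Real.exp (-x)) := by
  rw [expNeg, EReal.coe_ennreal_ofReal, max_eq_left hx, ← EReal.coe_neg, EReal.exp_coe]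

theorem expNeg_pos {x : ℝ≥0∞} (hx : x ≠ ∞) : expNeg x ≠ 0 := by
  simpa using (expNeg_strictAnti (lt_top_iff_ne_top.2 hx)).ne'

theorem expNeg_sum {ι : Type*} (s : Finset ι) (f : ι → ℝ≥0∞) :
    expNeg (∑ i ∈ s, f i) = ∏ i ∈ s, expNeg (f i) := by
  classical
  induction s using Finset.induction_on with
  | empty => simp
  | insert a s ha ih => rw [Finset.sum_insert ha, Finset.prod_insert ha, expNeg_add, ih]

theorem expNeg_nat_mul (n : ℕ) (x : ℝ≥0∞) : expNeg (n * x) = expNeg x ^ n := by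
  have := expNeg_sum (Finset.range n) fun _ => x
  simpa using this

theorem measurable_negLog : Measurable negLog := by
  unfold negLog
  exact (ENNReal.measurable_log.neg).ereal_toENNReal

@[fun_prop]
theorem Measurable.negLog {α : Type*} [MeasurableSpace α] {f : α → ℝ≥0∞} (hf : Measurable f) :
    Measurable fun x => negLog (f x) := measurable_negLog.comp hf

theorem expNeg_negLog {x : ℝ≥0∞} (hx : x ≤ 1) : expNeg (negLog x) = x := by
  rw [expNeg, negLog, EReal.coe_toENNReal, neg_neg, ENNReal.exp_log]
  rw [EReal.neg_nonneg]
  simpa using hx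

theorem Filter.Tendsto.expNeg {α : Type*} {l : Filter α} {f : α → ℝ≥0∞} {a : ℝ≥0∞}
    (hf : Filter.Tendsto f l (nhds a)) :
    Filter.Tendsto (fun x => expNeg (f x)) l (nhds (expNeg a)) :=
  (continuous_expNeg.tendsto a).comp hf

theorem one_sub_expNeg_le (x : ℝ≥0∞) : 1 - expNeg x ≤ x := by
  rcases eq_or_ne x ∞ with rfl | hx
  · simp
  lift x to ℝ≥0 using hx
  rw [← ENNReal.ofReal_coe_nnreal, expNeg_ofReal x.coe_nonneg, tsub_le_iff_right,
    ← ENNReal.ofReal_add x.coe_nonneg (Real.exp_nonneg _), ENNReal.one_le_ofReal]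
  linarith [Real.add_one_le_exp (-(x : ℝ))]

/-! ### Uniqueness theorems for Laplace transforms. -/

/-- A measure on a finite power of `[0, ∞]` is determined by its Laplace transform at the
natural numbers. -/
theorem ext_of_lintegral_expNeg_pi {ι : Type*} [Fintype ι] {μ₁ μ₂ : Measure (ι → ℝ≥0∞)}
    [IsFiniteMeasure μ₁] [IsFiniteMeasure μ₂]
    (h : ∀ n : ι → ℕ, ∫⁻ x, expNeg (∑ i, n i * x i) ∂μ₁ = ∫⁻ x, expNeg (∑ i, n i * x i) ∂μ₂) :
    μ₁ = μ₂ := by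
  classical
  let lin : (ι → ℕ) → (ι → ℝ≥0∞) → ℝ≥0∞ := fun n x => ∑ i, n i * x i
  have hlin : ∀ n, Continuous (lin n) := fun n =>
    continuous_finsetSum _ fun i _ =>
      (ENNReal.continuous_const_mul (ENNReal.natCast_ne_top _)).comp (continuous_apply i)
  have hcont : ∀ n, Continuous fun x => (expNeg (lin n x)).toReal := fun n =>
    ENNReal.continuousOn_toReal.comp_continuous (continuous_expNeg.comp (hlin n))
      fun x => expNeg_ne_top _
  let E : (ι → ℕ) → BoundedContinuousFunction (ι → ℝ≥0∞) ℝ := fun n =>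
    BoundedContinuousFunction.mkOfCompact ⟨fun x => (expNeg (lin n x)).toReal, hcont n⟩
  have hE : ∀ n x, E n x = (expNeg (lin n x)).toReal := fun n x => rfl
  -- The exponentials are closed under products, so the algebra that they generate is their linear
  -- span. It separates points of a compact Polish space, and integrals need only be compared on the
  -- exponentials.
  let S : Submonoid (BoundedContinuousFunction (ι → ℝ≥0∞) ℝ) :=
    { carrier := range E
      one_mem' := ⟨0, by ext x; simp [hE, lin]⟩
      mul_mem' := by
        rintro _ _ ⟨n, rfl⟩ ⟨m, rfl⟩
        refine ⟨n + m, ?_⟩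
        ext x
        simp only [hE, BoundedContinuousFunction.mul_apply, ← ENNReal.toReal_mul, ← expNeg_add]
        congr 2
        simp [lin, add_mul, Finset.sum_add_distrib] }
  let A : StarSubalgebra ℝ (BoundedContinuousFunction (ι → ℝ≥0∞) ℝ) :=
    { Algebra.adjoin ℝ (S : Set (BoundedContinuousFunction (ι → ℝ≥0∞) ℝ)) with
      star_mem' := fun {a} ha => by
        have : star a = a := by ext x; simp
        simpa only [this] using ha }
  have hint : ∀ n, ∫ x, E n x ∂μ₁ = ∫ x, E n x ∂μ₂ := fun n => by
    simp only [hE]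
    have hm : Measurable fun x => expNeg (lin n x) := (hlin n).measurable.expNeg
    rw [integral_toReal hm.aemeasurable, integral_toReal hm.aemeasurable, h n]
    all_goals exact .of_forall fun x => (expNeg_ne_top _).lt_top
  refine ext_of_forall_mem_subalgebra_integral_eq_of_polish (𝕜 := ℝ) (A := A) ?_ ?_
  · intro x y hxy
    obtain ⟨i, hi⟩ := Function.ne_iff.1 hxy
    refine ⟨_, ⟨(E (Pi.single i 1)).toContinuousMap, ?_, rfl⟩, ?_⟩
    · exact ⟨E (Pi.single i 1), Algebra.subset_adjoin ⟨_, rfl⟩, rfl⟩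
    · change E (Pi.single i 1) x ≠ E (Pi.single i 1) y
      have : ∀ z, lin (Pi.single i 1) z = z i := fun z => by
        simp [lin, Pi.single_apply]
      rw [hE, hE, this, this, Ne, ENNReal.toReal_eq_toReal_iff' (expNeg_ne_top _) (expNeg_ne_top _)]
      exact fun hh => hi (expNeg_strictAnti.injective hh)
  · intro g hg
    have hg' : g ∈ Submodule.span ℝ (S : Set (BoundedContinuousFunction (ι → ℝ≥0∞) ℝ)) := by
      have := Algebra.adjoin_eq_span ℝ (S : Set (BoundedContinuousFunction (ι → ℝ≥0∞) ℝ))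
      rw [Submonoid.closure_eq] at this
      rw [← this]; exact hg
    clear hg
    induction hg' using Submodule.span_induction with
    | mem g hg => obtain ⟨n, rfl⟩ := hg; exact hint n
    | zero => simp
    | add g₁ g₂ h₁ h₂ ih₁ ih₂ =>
      have e : ∀ μ : Measure (ι → ℝ≥0∞), [IsFiniteMeasure μ] →
          ∫ x, (g₁ + g₂) x ∂μ = ∫ x, g₁ x ∂μ + ∫ x, g₂ x ∂μ := fun μ _ =>
        integral_add (g₁.integrable μ) (g₂.integrable μ)
      rw [e, e, ih₁, ih₂]
    | smul c g h₁ ih₁ =>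
      have e : ∀ μ : Measure (ι → ℝ≥0∞), ∫ x, (c • g) x ∂μ = c * ∫ x, g x ∂μ := fun μ =>
        integral_const_mul c _
      rw [e, e, ih₁]

/-- A finite measure is determined on the σ-algebra generated by a family of `[0, ∞]`-valued
functions by the integrals of `exp (-∑ nᵢ fᵢ)`. -/
theorem ext_of_lintegral_expNeg {α κ : Type*} [mα : MeasurableSpace α] {μ₁ μ₂ : Measure α}
    [IsFiniteMeasure μ₁] [IsFiniteMeasure μ₂] (f : κ → α → ℝ≥0∞) (hf : ∀ k, Measurable (f k))
    (hgen : mα = ⨆ k, MeasurableSpace.comap (f k) inferInstance)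
    (h : ∀ (s : Finset κ) (n : s → ℕ), ∫⁻ x, expNeg (∑ i, n i * f i x) ∂μ₁ =
      ∫⁻ x, expNeg (∑ i, n i * f i x) ∂μ₂) :
    μ₁ = μ₂ := by
  have hs : ∀ s : Finset κ, μ₁.map (fun x (i : s) => f i x) = μ₂.map (fun x (i : s) => f i x) := by
    intro s
    have hm : Measurable fun x (i : s) => f i x := measurable_pi_lambda _ fun i => hf i
    have hl : ∀ n : s → ℕ, Measurable fun y : s → ℝ≥0∞ => expNeg (∑ i, n i * y i) := by
      intro n; fun_prop
    refine ext_of_lintegral_expNeg_pi fun n => ?_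
    rw [lintegral_map (hl n) hm, lintegral_map (hl n) hm, h s n]
  refine ext_of_generate_finite _ ?_ (isPiSystem_piiUnionInter
    (fun k => {t | MeasurableSet[MeasurableSpace.comap (f k) inferInstance] t})
    (fun k => @MeasurableSpace.isPiSystem_measurableSet _ (MeasurableSpace.comap (f k) _)) univ) ?_ ?_
  · have := generateFrom_piiUnionInter_measurableSet
      (fun k => MeasurableSpace.comap (f k) inferInstance) univ
    rw [this, hgen]; simp
  · rintro t ⟨s, -, g, hg, rfl⟩
    choose! B hB hBg using hg
    have e : ⋂ k ∈ s, g k = (fun x (i : s) => f i x) ⁻¹' (univ.pi fun i : s => B i) := by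
      ext x
      simp only [mem_iInter, mem_preimage, mem_pi, mem_univ, forall_const, Subtype.forall]
      refine forall₂_congr fun k hk => ?_
      rw [← hBg k hk]; rfl
    have hm : Measurable fun x (i : s) => f i x := measurable_pi_lambda _ fun i => hf i
    have hmB : MeasurableSet (univ.pi fun i : s => B i) :=
      MeasurableSet.univ_pi fun i => hB i i.2
    rw [e, ← Measure.map_apply hm hmB, hs s, Measure.map_apply hm hmB]
  · simpa using h ∅ (fun _ => 0)

/-! ### The Laplace functional of a Poisson process. -/

/-- This is the exponential series in `r exp (-x)`. The value `x = ∞` is allowed and yields the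
probability of the count `0`. -/
theorem lintegral_expNeg_poissonMeasure (r : ℝ≥0) (x : ℝ≥0∞) :
    ∫⁻ k : ℕ, expNeg (x * k) ∂(poissonMeasure r) = expNeg ((1 - expNeg x) * r) := by
  obtain ⟨y, hy0, hy1, hy⟩ : ∃ y : ℝ, 0 ≤ y ∧ y ≤ 1 ∧ expNeg x = ENNReal.ofReal y :=
    ⟨(expNeg x).toReal, ENNReal.toReal_nonneg, ENNReal.toReal_le_of_le_ofReal zero_le_one
      (by simpa using expNeg_le_one x), (ENNReal.ofReal_toReal (expNeg_ne_top x)).symm⟩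
  have h1 : ∀ k : ℕ, expNeg (x * k) * poissonMeasure r {k} =
      ENNReal.ofReal (Real.exp (-r) * ((r * y) ^ k / (k.factorial : ℝ))) := fun k => by
    rw [mul_comm x, expNeg_nat_mul, hy, poissonMeasure_singleton, ← ENNReal.ofReal_pow hy0,
      ← ENNReal.ofReal_mul (by positivity)]
    congr 1
    rw [mul_pow]; ring
  rw [lintegral_countable']
  simp_rw [h1]
  have hs : HasSum (fun k : ℕ => Real.exp (-r) * ((r * y) ^ k / (k.factorial : ℝ)))
      (Real.exp (-r) * Real.exp (r * y)) := by
    rw [Real.exp_eq_exp_ℝ]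
    exact (NormedSpace.expSeries_div_hasSum_exp (r * y : ℝ)).mul_left _
  have h2 : (1 - expNeg x) * r = ENNReal.ofReal ((1 - y) * r) := by
    rw [hy, ENNReal.ofReal_mul (by linarith), ENNReal.ofReal_sub _ hy0]; simp
  rw [← ENNReal.ofReal_tsum_of_nonneg (fun k => by positivity) hs.summable, hs.tsum_eq, h2,
    expNeg_ofReal (mul_nonneg (by linarith) r.coe_nonneg), ← Real.exp_add]
  congr 2; ring

section
variable {Ω E : Type*} [MeasurableSpace Ω] [MeasurableSpace E] {N : Ω → Measure E} {ν : Measure E}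
  {P : Measure Ω}

theorem IsPoissonProcess.measurable_apply (hN : IsPoissonProcess N ν P) {A : Set E}
    (hA : MeasurableSet A) : Measurable fun ω => N ω A :=
  (Measure.measurable_coe hA).comp hN.measurable

theorem IsPoissonProcess.measurable_lintegral (hN : IsPoissonProcess N ν P) {g : E → ℝ≥0∞}
    (hg : Measurable g) : Measurable fun ω => ∫⁻ z, g z ∂(N ω) :=
  (Measure.measurable_lintegral hg).comp hN.measurable

theorem IsPoissonProcess.lintegral_expNeg_mul_apply (hN : IsPoissonProcess N ν P)
    {A : Set E} (hA : MeasurableSet A) (hνA : ν A ≠ ∞) (x : ℝ≥0∞) :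
    ∫⁻ ω, expNeg (x * N ω A) ∂P = expNeg ((1 - expNeg x) * ν A) := by
  have hm : Measurable fun y => expNeg (x * y) := by fun_prop
  have h1 : ∫⁻ ω, expNeg (x * N ω A) ∂P = ∫⁻ y, expNeg (x * y) ∂(P.map fun ω => N ω A) :=
    (lintegral_map hm (hN.measurable_apply hA)).symm
  rw [h1, hN.poisson A hA hνA, lintegral_map hm .of_discrete,
    lintegral_expNeg_poissonMeasure, ENNReal.coe_toNNReal hνA]

/-- The fibres of `φ` are disjoint, so their counts are independent and the expectation factorizes.
The fibre over `0` may have infinite intensity, but it contributes the factor `1` on both sides. -/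
theorem IsPoissonProcess.lintegral_expNeg_simpleFunc [IsProbabilityMeasure P]
    (hN : IsPoissonProcess N ν P)
    (φ : SimpleFunc E ℝ≥0∞) (hφ : ∀ x ≠ 0, ν (φ ⁻¹' {x}) ≠ ∞) :
    ∫⁻ ω, expNeg (∫⁻ z, φ z ∂(N ω)) ∂P = expNeg (∫⁻ z, (1 - expNeg (φ z)) ∂ν) := by
  classical
  have h1 : ∀ ω, ∫⁻ z, φ z ∂(N ω) = ∑ x ∈ φ.range, x * N ω (φ ⁻¹' {x}) := fun ω =>
    φ.lintegral_eq_lintegral _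
  have h2 : ∫⁻ z, (1 - expNeg (φ z)) ∂ν = ∑ x ∈ φ.range, (1 - expNeg x) * ν (φ ⁻¹' {x}) :=
    (SimpleFunc.lintegral_eq_lintegral (φ.map fun x => 1 - expNeg x) ν).trans
      (φ.map_lintegral (fun x => 1 - expNeg x))
  let e := φ.range.equivFin
  have hi := hN.indep φ.range.card (fun i => φ ⁻¹' {(e.symm i : ℝ≥0∞)})
    (fun i => φ.measurableSet_fiber _) (fun i j hij => by
      refine Disjoint.preimage _ (disjoint_singleton.2 fun h => hij ?_)
      exact e.symm.injective (Subtype.ext h))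
  have hi' := hi.comp (fun i y => expNeg ((e.symm i : ℝ≥0∞) * y)) (fun i => by fun_prop)
  have h3 := lintegral_prod_eq_prod_lintegral_of_indepFun Finset.univ _ hi'
    (fun i => (Measurable.expNeg (by fun_prop)).comp
      (hN.measurable_apply (φ.measurableSet_fiber _)))
  have h4 : ∀ F : ℝ≥0∞ → ℝ≥0∞, ∏ x ∈ φ.range, F x = ∏ i, F (e.symm i : ℝ≥0∞) := fun F => by
    rw [← Finset.prod_coe_sort, ← e.symm.prod_comp]
  simp_rw [h1, h2, expNeg_sum, h4]
  refine h3.trans (Finset.prod_congr rfl fun i _ => ?_)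
  by_cases hx : (e.symm i : ℝ≥0∞) = 0
  · simp [hx]
  · exact hN.lintegral_expNeg_mul_apply (φ.measurableSet_fiber _) (hφ _ hx) _

theorem IsPoissonProcess.lintegral_expNeg [IsProbabilityMeasure P] [SigmaFinite ν]
    (hN : IsPoissonProcess N ν P) {g : E → ℝ≥0∞} (hg : Measurable g) :
    ∫⁻ ω, expNeg (∫⁻ z, g z ∂(N ω)) ∂P = expNeg (∫⁻ z, (1 - expNeg (g z)) ∂ν) := by
  -- Cutting off at the spanning sets gives every nonzero value a fibre of finite intensity, while
  -- the functions still increase to `g`.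
  let φ : ℕ → SimpleFunc E ℝ≥0∞ := fun n => (SimpleFunc.eapprox g n).restrict (spanningSets ν n)
  have hφ : ∀ n z, φ n z = (spanningSets ν n).indicator (SimpleFunc.eapprox g n) z := fun n z =>
    SimpleFunc.restrict_apply _ (measurableSet_spanningSets ν n) z
  have hmono : ∀ z, Monotone fun n => φ n z := fun z n m hnm => by
    simp only [hφ]
    exact (indicator_le_indicator_of_subset (monotone_spanningSets ν hnm) (fun _ => zero_le) z).trans
      (indicator_le_indicator (SimpleFunc.monotone_eapprox g hnm z))
  have hlim : ∀ z, Filter.Tendsto (fun n => φ n z) Filter.atTop (nhds (g z)) := fun z => by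
    have h1 := SimpleFunc.tendsto_eapprox hg z
    refine h1.congr' ?_
    filter_upwards [Filter.eventually_ge_atTop (spanningSetsIndex ν z)] with n hn
    rw [hφ, indicator_of_mem]
    exact monotone_spanningSets ν hn (mem_spanningSetsIndex ν z)
  have hfin : ∀ n, ∀ x ≠ 0, ν (φ n ⁻¹' {x}) ≠ ∞ := fun n x hx => by
    refine ((measure_mono fun z hz => ?_).trans_lt (measure_spanningSets_lt_top ν n)).ne
    by_contra hcon
    rw [mem_preimage, hφ, indicator_of_notMem hcon] at hz
    exact hx (by simpa using hz.symm)
  have hL : Filter.Tendsto (fun n => ∫⁻ ω, expNeg (∫⁻ z, φ n z ∂(N ω)) ∂P) Filter.atTop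
      (nhds (∫⁻ ω, expNeg (∫⁻ z, g z ∂(N ω)) ∂P)) := by
    refine tendsto_lintegral_of_dominated_convergence (fun _ => 1)
      (fun n => (hN.measurable_lintegral (φ n).measurable).expNeg)
      (fun n => .of_forall fun ω => expNeg_le_one _) (by simp) (.of_forall fun ω => ?_)
    exact (lintegral_tendsto_of_tendsto_of_monotone (fun n => (φ n).measurable.aemeasurable)
      (.of_forall hmono) (.of_forall hlim)).expNeg
  have hR : Filter.Tendsto (fun n => expNeg (∫⁻ z, (1 - expNeg (φ n z)) ∂ν)) Filter.atTop
      (nhds (expNeg (∫⁻ z, (1 - expNeg (g z)) ∂ν))) := by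
    refine (lintegral_tendsto_of_tendsto_of_monotone
      (fun n => (Measurable.const_sub (φ n).measurable.expNeg 1).aemeasurable)
      (.of_forall fun z n m hnm => tsub_le_tsub_left (expNeg_antitone (hmono z hnm)) _)
      (.of_forall fun z => ?_)).expNeg
    exact ENNReal.Tendsto.sub tendsto_const_nhds (hlim z).expNeg (.inl ENNReal.one_ne_top)
  refine tendsto_nhds_unique hL (hR.congr fun n => ?_)
  exact (hN.lintegral_expNeg_simpleFunc (φ n) (hfin n)).symm

end

/-! ### Finite products of integrals and of series. -/

/-- The integral over a product space of a product of functions of the coordinates. -/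
theorem lintegral_pi_prod {ι α : Type*} [Fintype ι] [MeasurableSpace α] (μ : Measure α)
    [SigmaFinite μ] (f : ι → α → ℝ≥0∞) (hf : ∀ i, Measurable (f i)) :
    ∫⁻ x, ∏ i, f i (x i) ∂(Measure.pi fun _ : ι => μ) = ∏ i, ∫⁻ x, f i x ∂μ := by
  have fin : ∀ (n : ℕ) (f : Fin n → α → ℝ≥0∞) (_ : ∀ i, Measurable (f i)),
      ∫⁻ x, ∏ i, f i (x i) ∂(Measure.pi fun _ : Fin n => μ) = ∏ i, ∫⁻ x, f i x ∂μ := by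
    intro n
    induction n with
    | zero => intro f _; simp
    | succ n ih =>
      intro f hf
      have e := (measurePreserving_piFinSuccAbove (fun _ : Fin (n + 1) => μ) 0).symm
      rw [← e.lintegral_comp_emb (MeasurableEquiv.measurableEmbedding _)]
      have h1 : ∀ a : α × (Fin n → α), ∏ i, f i
          ((MeasurableEquiv.piFinSuccAbove (fun _ : Fin (n + 1) => α) 0).symm a i) =
          f 0 a.1 * ∏ i : Fin n, f i.succ (a.2 i) := fun a => by
        rw [Fin.prod_univ_succ]; rfl
      rw [lintegral_congr h1, Fin.prod_univ_succ, ← ih _ fun i => hf _]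
      exact lintegral_prod_mul (f := f 0) (g := fun y : Fin n → α => ∏ i : Fin n, f i.succ (y i))
        (hf 0).aemeasurable
        (Finset.measurable_prod _ fun i _ => (hf _).comp (measurable_pi_apply i)).aemeasurable
  let e := (Fintype.equivFin ι).symm
  have := (measurePreserving_piCongrLeft (fun _ : ι => μ) e)
  rw [← this.lintegral_comp_emb (MeasurableEquiv.measurableEmbedding _)]
  simp_rw [← e.prod_comp, MeasurableEquiv.coe_piCongrLeft, Equiv.piCongrLeft_apply_apply]
  exact fin _ _ fun i => hf _

/-- A finite product of series is the series of the products. -/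
theorem ENNReal.prod_tsum {ι : Type*} [Fintype ι] (f : ι → ℕ → ℝ≥0∞) :
    ∏ i, ∑' k, f i k = ∑' e : ι → ℕ, ∏ i, f i (e i) := by
  have h := lintegral_pi_prod (Measure.count : Measure ℕ) f
    fun i => measurable_of_countable _
  simp_rw [lintegral_count] at h
  rw [← h, lintegral_countable']
  refine tsum_congr fun e => ?_
  rw [← univ_pi_singleton, Measure.pi_pi]; simp

/-! ### Ranked points of a configuration. -/

theorem rankedPoint_nonneg (m : Measure ℝ) (k : ℕ) : 0 ≤ rankedPoint m k :=
  Real.sInf_nonneg fun _ hx => hx.1.le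

/-- The first alternative accounts for the convention `sInf ∅ = 0`: it says that no level has at
most `k` points above it. Integer and rational levels suffice by monotonicity, which is what
measurability needs. -/
theorem rankedPoint_lt_iff (m : Measure ℝ) (k : ℕ) {y : ℝ} (hy : 0 < y) :
    rankedPoint m k < y ↔ (∀ n : ℕ, ¬ m (Ioi ((n : ℝ) + 1)) ≤ k) ∨
      ∃ q : ℚ, 0 < (q : ℝ) ∧ (q : ℝ) < y ∧ m (Ioi (q : ℝ)) ≤ k := by
  have hbdd : BddBelow {x : ℝ | 0 < x ∧ m (Ioi x) ≤ k} := ⟨0, fun x hx => hx.1.le⟩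
  constructor
  · intro h
    by_cases hne : {x : ℝ | 0 < x ∧ m (Ioi x) ≤ k}.Nonempty
    · right
      obtain ⟨x, ⟨hx0, hx⟩, hxy⟩ := exists_lt_of_csInf_lt hne h
      obtain ⟨q, hq1, hq2⟩ := exists_rat_btwn hxy
      exact ⟨q, hx0.trans hq1, hq2, (measure_mono (Ioi_subset_Ioi hq1.le)).trans hx⟩
    · left
      intro n hn
      exact hne ⟨(n : ℝ) + 1, by positivity, hn⟩
  · rintro (h | ⟨q, hq0, hqy, hq⟩)
    · have : {x : ℝ | 0 < x ∧ m (Ioi x) ≤ k} = ∅ := by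
        ext x
        simp only [mem_ofPred_eq, mem_empty_iff_false, iff_false, not_and]
        intro hx hk
        obtain ⟨n, hn⟩ := exists_nat_ge x
        exact h n ((measure_mono (Ioi_subset_Ioi (by linarith))).trans hk)
      rw [rankedPoint, this, Real.sInf_empty]
      exact hy
    · exact (csInf_le hbdd ⟨hq0, hq⟩).trans_lt hqy

theorem measurable_rankedPoint (k : ℕ) : Measurable fun m : Measure ℝ => rankedPoint m k := by
  refine measurable_of_Iio fun y => ?_
  rcases le_or_gt y 0 with hy | hy
  · convert MeasurableSet.empty
    ext m
    simpa using hy.trans (rankedPoint_nonneg m k)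
  · have : (fun m : Measure ℝ => rankedPoint m k) ⁻¹' Iio y =
        (⋂ n : ℕ, {m : Measure ℝ | m (Ioi ((n : ℝ) + 1)) ≤ k}ᶜ) ∪
          ⋃ q : ℚ, {m : Measure ℝ | 0 < (q : ℝ) ∧ (q : ℝ) < y ∧ m (Ioi (q : ℝ)) ≤ k} := by
      ext m
      simp [rankedPoint_lt_iff m k hy]
    rw [this]
    have hm : ∀ x : ℝ, MeasurableSet {m : Measure ℝ | m (Ioi x) ≤ k} := fun x =>
      measurableSet_le (Measure.measurable_coe measurableSet_Ioi) measurable_const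
    exact (MeasurableSet.iInter fun n => (hm _).compl).union (MeasurableSet.iUnion fun q =>
      (MeasurableSet.const _).inter ((MeasurableSet.const _).inter (hm _)))

/-- A configuration of infinitely many points of `(0, ∞)` that accumulate only at `0`. -/
structure IsPointConfiguration (m : Measure ℝ) : Prop where
  null : m (Iic 0) = 0
  infinite : m univ = ∞
  count : ∀ q : ℚ, 0 < q → ∃ n : ℕ, m (Ioi (q : ℝ)) = n

namespace IsPointConfiguration

variable {m : Measure ℝ}

theorem lt_top (hm : IsPointConfiguration m) {x : ℝ} (hx : 0 < x) : m (Ioi x) < ∞ := by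
  obtain ⟨q, hq0, hqx⟩ := exists_rat_btwn hx
  obtain ⟨n, hn⟩ := hm.count q (by exact_mod_cast hq0)
  exact (measure_mono (Ioi_subset_Ioi hqx.le)).trans_lt (hn ▸ ENNReal.natCast_lt_top n)

theorem measure_Ioi_eq_iSup (m : Measure ℝ) {x : ℝ} {u : ℕ → ℝ} (hu : Antitone u)
    (hux : ∀ j, x < u j) (hlim : Filter.Tendsto u Filter.atTop (nhds x)) :
    m (Ioi x) = ⨆ j, m (Ioi (u j)) := by
  rw [← Monotone.measure_iUnion (fun i j hij => Ioi_subset_Ioi (hu hij))]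
  congr 1
  ext y
  simp only [mem_Ioi, mem_iUnion]
  refine ⟨fun h => ?_, fun ⟨j, hj⟩ => (hux j).trans hj⟩
  exact ((tendsto_order.1 hlim).2 y h).exists

/-- Counts above rationals decreasing to `x` form a bounded set of natural numbers, so their
supremum is attained. -/
theorem exists_nat (hm : IsPointConfiguration m) {x : ℝ} (hx : 0 < x) :
    ∃ n : ℕ, m (Ioi x) = n := by
  obtain ⟨u, hu, hux, hlim⟩ := Real.exists_seq_rat_strictAnti_tendsto x
  have hpos : ∀ j, 0 < u j := fun j => by exact_mod_cast hx.trans (hux j)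
  choose! n hn using fun j => hm.count (u j) (hpos j)
  have hsup := measure_Ioi_eq_iSup m (u := fun j => (u j : ℝ))
    (fun i j hij => Rat.cast_le.2 (hu.antitone hij)) hux hlim
  have hbdd : BddAbove (range n) := by
    obtain ⟨b, hb⟩ := ENNReal.exists_nat_gt (hm.lt_top hx).ne
    refine ⟨b, ?_⟩
    rintro _ ⟨j, rfl⟩
    have : (n j : ℝ≥0∞) ≤ b := by
      rw [← hn j]
      exact (measure_mono (Ioi_subset_Ioi (hux j).le)).trans hb.le
    exact_mod_cast this
  obtain ⟨j, hj⟩ := Nat.sSup_mem (range_nonempty n) hbdd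
  refine ⟨n j, le_antisymm ?_ ?_⟩
  · rw [hsup]
    refine iSup_le fun i => ?_
    rw [hn i]
    exact_mod_cast hj ▸ le_csSup hbdd (mem_range_self i)
  · rw [← hn j]
    exact measure_mono (Ioi_subset_Ioi (hux j).le)

/-- The count above `x` is right continuous in `x`, so the bound on the counts survives in the
infimum. -/
theorem lt_rankedPoint_iff (hm : IsPointConfiguration m) {x : ℝ} (hx : 0 < x) (k : ℕ) :
    x < rankedPoint m k ↔ (k : ℝ≥0∞) < m (Ioi x) := by
  have hbdd : BddBelow {x : ℝ | 0 < x ∧ m (Ioi x) ≤ k} := ⟨0, fun x hx => hx.1.le⟩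
  rw [← not_iff_not, not_lt, not_lt]
  refine ⟨fun h => ?_, fun h => csInf_le hbdd ⟨hx, h⟩⟩
  obtain ⟨u, hu, hux, hlim⟩ := exists_seq_strictAnti_tendsto x
  rw [measure_Ioi_eq_iSup m hu.antitone hux hlim]
  refine iSup_le fun j => ?_
  -- The infimum is over a nonempty set: the counts above `n + 1` tend to `0` and are integers, so
  -- they are eventually `0`.
  have hne : {x : ℝ | 0 < x ∧ m (Ioi x) ≤ k}.Nonempty := by
    have h0 : Filter.Tendsto (fun n : ℕ => m (Ioi ((n : ℝ) + 1))) Filter.atTop (nhds 0) := by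
      have := tendsto_measure_iInter_atTop (μ := m) (s := fun n : ℕ => Ioi ((n : ℝ) + 1))
        (fun n => measurableSet_Ioi.nullMeasurableSet)
        (fun i j hij => Ioi_subset_Ioi (by gcongr))
        ⟨0, (hm.lt_top (by positivity)).ne⟩
      have hempty : ⋂ n : ℕ, Ioi ((n : ℝ) + 1) = ∅ := by
        ext y
        simp only [mem_iInter, mem_Ioi, mem_empty_iff_false, iff_false, not_forall, not_lt]
        obtain ⟨n, hn⟩ := exists_nat_ge y
        exact ⟨n, by linarith⟩
      rwa [hempty, measure_empty] at this
    obtain ⟨n, hn⟩ := ((tendsto_order.1 h0).2 1 one_pos).exists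
    obtain ⟨a, ha⟩ := hm.exists_nat (x := (n : ℝ) + 1) (by positivity)
    refine ⟨(n : ℝ) + 1, by positivity, ?_⟩
    rw [ha] at hn ⊢
    have : a = 0 := by
      have : a < 1 := by exact_mod_cast hn
      omega
    simp [this]
  obtain ⟨z, ⟨hz0, hz⟩, hzu⟩ := exists_lt_of_csInf_lt hne (h.trans_lt (hux j))
  exact (measure_mono (Ioi_subset_Ioi hzu.le)).trans hz

theorem rankedPoint_pos (hm : IsPointConfiguration m) (k : ℕ) : 0 < rankedPoint m k := by
  obtain ⟨u, hu, hux, hlim⟩ := exists_seq_strictAnti_tendsto (0 : ℝ)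
  have h1 : m (Ioi 0) = ∞ := by
    have := measure_union_le (μ := m) (Iic 0) (Ioi 0)
    rw [Iic_union_Ioi, hm.infinite, hm.null, zero_add] at this
    exact top_le_iff.1 this
  rw [measure_Ioi_eq_iSup m hu.antitone hux hlim] at h1
  obtain ⟨j, hj⟩ := lt_iSup_iff.1 (h1 ▸ ENNReal.natCast_lt_top k)
  exact (hux j).trans ((hm.lt_rankedPoint_iff (hux j) k).2 hj)

/-- Exactly the first `m (Ioi x)` ranked points exceed `x`, so both measures have the same tails.
Tails determine the restrictions to `(1 / (j + 1), ∞)`, which are finite, and these cover `(0, ∞)`.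
-/
theorem eq_sum_dirac (hm : IsPointConfiguration m) :
    m = Measure.sum fun k => Measure.dirac (rankedPoint m k) := by
  set m' := Measure.sum fun k => Measure.dirac (rankedPoint m k) with hm'
  have hIoi : ∀ x : ℝ, 0 < x → m' (Ioi x) = m (Ioi x) := by
    intro x hx
    obtain ⟨n, hn⟩ := hm.exists_nat hx
    rw [hm', Measure.sum_apply _ measurableSet_Ioi]
    have h1 : ∀ k, Measure.dirac (rankedPoint m k) (Ioi x) =
        if k ∈ Finset.range n then 1 else 0 := fun k => by
      rw [Measure.dirac_apply' _ measurableSet_Ioi, indicator_apply]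
      have := hm.lt_rankedPoint_iff hx k
      rw [hn, Nat.cast_lt] at this
      simp [this]
    simp_rw [h1]
    rw [tsum_eq_sum (s := Finset.range n) (fun k hk => if_neg hk), Finset.sum_ite_mem]
    simp [hn]
  have hnull : m' (Iic 0) = 0 := by
    rw [hm', Measure.sum_apply _ measurableSet_Iic, ENNReal.tsum_eq_zero]
    intro k
    rw [Measure.dirac_apply' _ measurableSet_Iic, indicator_of_notMem]
    simpa using hm.rankedPoint_pos k
  have hres : ∀ μ : Measure ℝ, μ (Iic 0) = 0 → μ.restrict (Ioi 0) = μ := fun μ hμ => by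
    refine Measure.restrict_eq_self_of_ae_mem ?_
    rw [ae_iff]
    convert hμ using 2
    ext; simp
  rw [← hres m hm.null, ← hres m' hnull]
  have hU : Ioi (0 : ℝ) = ⋃ j : ℕ, Ioi (1 / ((j : ℝ) + 1)) := by
    ext y
    simp only [mem_Ioi, mem_iUnion]
    exact ⟨fun h => exists_nat_one_div_lt h, fun ⟨j, hj⟩ => lt_trans (by positivity) hj⟩
  rw [hU, Measure.restrict_iUnion_congr]
  intro j
  have hε : 0 < 1 / ((j : ℝ) + 1) := by positivity
  have : IsFiniteMeasure (m.restrict (Ioi (1 / ((j : ℝ) + 1)))) :=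
    ⟨by simpa using hm.lt_top hε⟩
  refine ext_of_generate_finite (range Ioi) ?_ isPiSystem_Ioi ?_ ?_
  · rw [← borel_eq_generateFrom_Ioi]
    exact BorelSpace.measurable_eq
  · rintro _ ⟨a, rfl⟩
    rw [Measure.restrict_apply measurableSet_Ioi, Measure.restrict_apply measurableSet_Ioi,
      Ioi_inter_Ioi, hIoi _ (lt_sup_of_lt_right hε)]
  · rw [Measure.restrict_apply_univ, Measure.restrict_apply_univ, hIoi _ hε]

theorem lintegral_eq_tsum (hm : IsPointConfiguration m) {g : ℝ → ℝ≥0∞} (hg : Measurable g) :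
    ∫⁻ s, g s ∂m = ∑' k, g (rankedPoint m k) := by
  conv_lhs => rw [hm.eq_sum_dirac]
  rw [lintegral_sum_measure]
  simp_rw [lintegral_dirac' _ hg]

end IsPointConfiguration

/-- The points of a Poisson process with infinite intensity measure that is finite away from
`0`. -/
theorem IsPoissonProcess.ae_isPointConfiguration {Ω : Type*} [MeasurableSpace Ω]
    {P : Measure Ω} [IsProbabilityMeasure P] {ρ : Measure ℝ} [SigmaFinite ρ] {M : Ω → Measure ℝ}
    (hM : IsPoissonProcess M ρ P) (h0 : ρ (Iic 0) = 0) (hinf : ρ univ = ∞)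
    (hfin : ∀ x : ℝ, 0 < x → ρ (Ioi x) < ∞) : ∀ᵐ ω ∂P, IsPointConfiguration (M ω) := by
  have hcount : ∀ A : Set ℝ, MeasurableSet A → ρ A ≠ ∞ → ∀ᵐ ω ∂P, ∃ n : ℕ, M ω A = n := by
    intro A hA hρ
    have h1 : ∀ᵐ (y : ℝ≥0∞) ∂(P.map fun ω => M ω A), ∃ n : ℕ, y = n := by
      have hset : MeasurableSet {y : ℝ≥0∞ | ∃ n : ℕ, y = n} := by
        convert (countable_range (fun n : ℕ => (n : ℝ≥0∞))).measurableSet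
        ext; simp [eq_comm]
      rw [hM.poisson A hA hρ, ae_map_iff Measurable.of_discrete.aemeasurable hset]
      exact .of_forall fun n => ⟨n, rfl⟩
    exact ae_of_ae_map (hM.measurable_apply hA).aemeasurable h1
  have hnull : ∀ᵐ ω ∂P, M ω (Iic 0) = 0 := by
    -- With the parameter `∞`, the exponential becomes the indicator of the event that the set
    -- contains no points.
    have h1 := hM.lintegral_expNeg_mul_apply measurableSet_Iic (by simp [h0]) ∞ (A := Iic 0)
    rw [h0, mul_zero, expNeg_zero] at h1
    have hmeas := (hM.measurable_apply (A := Iic 0) measurableSet_Iic)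
    have h2 : ∫⁻ ω, (1 - expNeg (∞ * M ω (Iic 0))) ∂P = 0 := by
      rw [lintegral_sub (by fun_prop) (by simp [h1]) (.of_forall fun ω => expNeg_le_one _), h1]
      simp
    rw [lintegral_eq_zero_iff (by fun_prop)] at h2
    filter_upwards [h2] with ω hω
    by_contra hne
    simp [ENNReal.top_mul hne] at hω
  have htop : ∀ᵐ ω ∂P, M ω univ = ∞ := by
    -- For the constant `1` the right side is `exp (-(1 - exp (-1)) · ∞) = 0`, so the total count is
    -- almost surely infinite.
    have h1 := hM.lintegral_expNeg (g := fun _ => 1) measurable_const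
    have hmeas := (hM.measurable_apply (A := univ) MeasurableSet.univ)
    have h3 : 1 - expNeg 1 ≠ 0 := by
      rw [Ne, tsub_eq_zero_iff_le, not_le]
      simpa using expNeg_strictAnti (one_pos (α := ℝ≥0∞))
    simp only [lintegral_const, one_mul, hinf, ENNReal.mul_top h3, expNeg_top] at h1
    rw [lintegral_eq_zero_iff (by fun_prop)] at h1
    filter_upwards [h1] with ω hω
    by_contra hne
    exact expNeg_pos hne hω
  have hall : ∀ᵐ ω ∂P, ∀ q : ℚ, 0 < q → ∃ n : ℕ, M ω (Ioi (q : ℝ)) = n := by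
    rw [ae_all_iff]
    intro q
    by_cases hq : 0 < q
    · filter_upwards [hcount _ measurableSet_Ioi (hfin q (by exact_mod_cast hq)).ne] with ω h _
        using h
    · exact .of_forall fun ω h => absurd h hq
  filter_upwards [hnull, htop, hall] with ω h1 h2 h3 using ⟨h1, h2, h3⟩

/-! ### Independent marks attached to the ranked points. -/

/-- Independence gives a product of expectations. Writing it with `negLog` turns the infinite
product into a series over the points, to which a Laplace functional can be applied. Vanishing
factors are covered, since `negLog 0 = ∞`. -/
theorem lintegral_expNeg_tsum_infinitePi {X : Type*} [MeasurableSpace X] (η : Measure X)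
    [IsProbabilityMeasure η] (g : ℕ → X → ℝ≥0∞) (hg : ∀ k, Measurable (g k)) :
    ∫⁻ z, expNeg (∑' k, g k (z k)) ∂(Measure.infinitePi fun _ : ℕ => η) =
      expNeg (∑' k, negLog (∫⁻ x, expNeg (g k x) ∂η)) := by
  have hle : ∀ k, ∫⁻ x, expNeg (g k x) ∂η ≤ 1 := fun k =>
    (lintegral_mono fun x => expNeg_le_one _).trans (by simp)
  have hi := iIndepFun_infinitePi (P := fun _ : ℕ => η) (X := fun k x => expNeg (g k x))
    (fun k => by fun_prop)
  have hfin : ∀ n, ∫⁻ z, expNeg (∑ k ∈ Finset.range n, g k (z k))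
      ∂(Measure.infinitePi fun _ : ℕ => η) =
      expNeg (∑ k ∈ Finset.range n, negLog (∫⁻ x, expNeg (g k x) ∂η)) := fun n => by
    simp_rw [expNeg_sum, expNeg_negLog (hle _)]
    rw [lintegral_prod_eq_prod_lintegral_of_indepFun _ _ hi fun k => by fun_prop]
    refine Finset.prod_congr rfl fun k _ => ?_
    exact (measurePreserving_eval_infinitePi (fun _ : ℕ => η) k).lintegral_comp (hg k).expNeg
  have hL : Filter.Tendsto (fun n => ∫⁻ z, expNeg (∑ k ∈ Finset.range n, g k (z k))
      ∂(Measure.infinitePi fun _ : ℕ => η)) Filter.atTop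
      (nhds (∫⁻ z, expNeg (∑' k, g k (z k)) ∂(Measure.infinitePi fun _ : ℕ => η))) := by
    refine tendsto_lintegral_of_dominated_convergence (fun _ => 1)
      (fun n => by fun_prop) (fun n => .of_forall fun ω => expNeg_le_one _) (by simp)
      (.of_forall fun z => ?_)
    exact (ENNReal.tendsto_nat_tsum fun k => g k (z k)).expNeg
  refine tendsto_nhds_unique hL ?_
  simp_rw [hfin]
  exact (ENNReal.tendsto_nat_tsum _).expNeg

/-- This is the marking theorem. Averaging over the marks replaces `exp (-g)` by its `η`-mean, and
the Laplace functional of `M` at minus the logarithm of that mean gives the result. -/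
theorem IsPoissonProcess.lintegral_expNeg_marked {Ω X : Type*} [MeasurableSpace Ω]
    [MeasurableSpace X] {P : Measure Ω} [IsProbabilityMeasure P] {ρ : Measure ℝ} [SigmaFinite ρ]
    {M : Ω → Measure ℝ} (hM : IsPoissonProcess M ρ P)
    (hcfg : ∀ᵐ ω ∂P, IsPointConfiguration (M ω)) (η : Measure X) [IsProbabilityMeasure η]
    {g : X → ℝ → ℝ≥0∞} (hg : Measurable fun z : X × ℝ => g z.1 z.2) :
    ∫⁻ ω, ∫⁻ z, expNeg (∑' k, g (z k) (rankedPoint (M ω) k))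
      ∂(Measure.infinitePi fun _ : ℕ => η) ∂P =
      expNeg (∫⁻ s, ∫⁻ x, (1 - expNeg (g x s)) ∂η ∂ρ) := by
  have hgs : ∀ s, Measurable fun x => g x s := fun s => hg.comp measurable_prodMk_right
  have hle : ∀ s, ∫⁻ x, expNeg (g x s) ∂η ≤ 1 := fun s =>
    (lintegral_mono fun x => expNeg_le_one _).trans (by simp)
  have hgm : Measurable fun s => ∫⁻ x, expNeg (g x s) ∂η :=
    Measurable.lintegral_prod_right' (f := fun p : ℝ × X => expNeg (g p.2 p.1))
      (hg.comp measurable_swap).expNeg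
  have h1 : ∫⁻ ω, ∫⁻ z, expNeg (∑' k, g (z k) (rankedPoint (M ω) k))
      ∂(Measure.infinitePi fun _ : ℕ => η) ∂P =
      ∫⁻ ω, expNeg (∫⁻ s, negLog (∫⁻ x, expNeg (g x s) ∂η) ∂(M ω)) ∂P := by
    refine lintegral_congr_ae ?_
    filter_upwards [hcfg] with ω hω
    rw [hω.lintegral_eq_tsum hgm.negLog]
    exact lintegral_expNeg_tsum_infinitePi η (fun k x => g x (rankedPoint (M ω) k))
      fun k => hgs _
  rw [h1, hM.lintegral_expNeg hgm.negLog]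
  congr 1
  refine lintegral_congr fun s => ?_
  rw [expNeg_negLog (hle s), lintegral_sub (hgs s).expNeg ((hle s).trans_lt ENNReal.one_lt_top).ne
    (.of_forall fun x => expNeg_le_one _)]
  simp

/-! ### Atomic measures and the law of the completely random measure. -/

/-- The discrete measure with atoms of mass `w k` at `z k`. -/
noncomputable def atomicMeasure {X : Type*} [MeasurableSpace X] (w : ℕ → ℝ) (z : ℕ → X) :
    Measure X :=
  Measure.sum fun k : ℕ => ENNReal.ofReal (w k) • Measure.dirac (z k)

section atomicMeasure

variable {X : Type*} [MeasurableSpace X]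

theorem lintegral_atomicMeasure (w : ℕ → ℝ) (z : ℕ → X) {G : X → ℝ≥0∞} (hG : Measurable G) :
    ∫⁻ x, G x ∂(atomicMeasure w z) = ∑' k, ENNReal.ofReal (w k) * G (z k) := by
  rw [atomicMeasure, lintegral_sum_measure]
  simp_rw [lintegral_smul_measure, lintegral_dirac' _ hG, smul_eq_mul]

theorem atomicMeasure_apply (w : ℕ → ℝ) (z : ℕ → X) {A : Set X} (hA : MeasurableSet A) :
    atomicMeasure w z A = ∑' k, ENNReal.ofReal (w k) * A.indicator 1 (z k) := by
  rw [← lintegral_indicator_one hA, lintegral_atomicMeasure _ _ (measurable_one.indicator hA)]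

theorem atomicMeasure_univ (w : ℕ → ℝ) (z : ℕ → X) :
    atomicMeasure w z univ = ∑' k, ENNReal.ofReal (w k) := by
  simp [atomicMeasure_apply w z MeasurableSet.univ]

theorem measurable_atomicMeasure {α : Type*} [MeasurableSpace α] {w : α → ℕ → ℝ} {z : α → ℕ → X}
    (hw : Measurable w) (hz : Measurable z) : Measurable fun a => atomicMeasure (w a) (z a) := by
  refine Measure.measurable_of_measurable_coe _ fun A hA => ?_
  simp_rw [atomicMeasure_apply _ _ hA]
  refine Measurable.tsum fun k => ?_
  exact (measurable_pi_iff.1 hw k).ennreal_ofReal.mul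
    ((measurable_one.indicator hA).comp (measurable_pi_iff.1 hz k))

end atomicMeasure

theorem lintegral_crm {X : Type*} [MeasurableSpace X] (N : Measure (X × ℝ)) {G : X → ℝ≥0∞}
    (hG : Measurable G) :
    ∫⁻ x, G x ∂(crm N) = ∫⁻ z, ENNReal.ofReal z.2 * G z.1 ∂N := by
  have h1 : Measurable fun z : X × ℝ => ENNReal.ofReal z.2 := by fun_prop
  rw [crm, lintegral_map hG measurable_fst,
    lintegral_withDensity_eq_lintegral_mul _ h1 (g := fun z => G z.1) (hG.comp measurable_fst)]
  rfl

/-- A finite measure on the space of measures is determined by its Laplace functional. -/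
theorem ext_of_laplaceFunctional {X : Type*} [MeasurableSpace X] {Q₁ Q₂ : Measure (Measure X)}
    [IsFiniteMeasure Q₁] [IsFiniteMeasure Q₂]
    (h : ∀ G : X → ℝ≥0∞, Measurable G →
      ∫⁻ m, expNeg (∫⁻ x, G x ∂m) ∂Q₁ = ∫⁻ m, expNeg (∫⁻ x, G x ∂m) ∂Q₂) : Q₁ = Q₂ := by
  refine ext_of_lintegral_expNeg (κ := {A : Set X // MeasurableSet A}) (fun A m => m A)
    (fun A => Measure.measurable_coe A.2) ?_ fun s n => ?_
  · rw [iSup_subtype]; rfl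
  · have e : ∀ m : Measure X, ∑ i : s, (n i : ℝ≥0∞) * m ((i : {A : Set X // MeasurableSet A}) : Set X) =
        ∫⁻ x, ∑ i : s, (n i : ℝ≥0∞) *
          ((i : {A : Set X // MeasurableSet A}) : Set X).indicator 1 x ∂m := fun m => by
      rw [lintegral_finsetSum _ fun i _ => (measurable_one.indicator i.1.2).const_mul _]
      refine Finset.sum_congr rfl fun i _ => ?_
      rw [lintegral_const_mul _ (measurable_one.indicator i.1.2), lintegral_indicator_one i.1.2]
    simp_rw [e]
    exact h _ (Finset.measurable_sum _ fun i _ => (measurable_one.indicator i.1.2).const_mul _)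

theorem measurable_rankedPoint_seq :
    Measurable rankedPoint :=
  measurable_pi_lambda _ fun k => measurable_rankedPoint k

/-- The completely random measure of a Poisson process with intensity `η ⊗ ρ` has the law of
`∑ Jₖ δ_{Zₖ}`, where the `Jₖ` are the ranked points of a Poisson process with intensity `ρ` and
the `Zₖ` are independent with law `η`. -/
theorem IsPoissonProcess.map_crm {Ω Ω₀ X : Type*} [MeasurableSpace Ω] [MeasurableSpace Ω₀]
    [MeasurableSpace X] {P : Measure Ω} [IsProbabilityMeasure P] {P₀ : Measure Ω₀}
    [IsProbabilityMeasure P₀] {η : Measure X} [IsProbabilityMeasure η] {ρ : Measure ℝ}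
    [SigmaFinite ρ] {N : Ω → Measure (X × ℝ)} (hN : IsPoissonProcess N (η.prod ρ) P)
    {M : Ω₀ → Measure ℝ} (hM : IsPoissonProcess M ρ P₀)
    (hcfg : ∀ᵐ ω ∂P₀, IsPointConfiguration (M ω)) :
    P.map (fun ω => crm (N ω)) = (P₀.prod (Measure.infinitePi fun _ : ℕ => η)).map
      (fun p => atomicMeasure (rankedPoint (M p.1)) p.2) := by
  have hm1 : Measurable fun ω => crm (N ω) := measurable_crm.comp hN.measurable
  have hm2 := measurable_atomicMeasure (X := X) (α := Ω₀ × (ℕ → X))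
    (w := fun p => rankedPoint (M p.1))
    (measurable_rankedPoint_seq.comp (hM.measurable.comp measurable_fst)) measurable_snd
  have := Measure.isProbabilityMeasure_map (μ := P) hm1.aemeasurable
  have := Measure.isProbabilityMeasure_map
    (μ := P₀.prod (Measure.infinitePi fun _ : ℕ => η)) hm2.aemeasurable
  refine ext_of_laplaceFunctional fun G hG => ?_
  have hmG := (Measure.measurable_lintegral hG).expNeg
  have hg : Measurable fun z : X × ℝ => ENNReal.ofReal z.2 * G z.1 := by fun_prop
  have h1 : Measurable fun z : X × ℝ => 1 - expNeg (ENNReal.ofReal z.2 * G z.1) :=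
    hg.expNeg.const_sub 1
  have h2 : Measurable fun p : Ω₀ × (ℕ → X) =>
      expNeg (∑' k, ENNReal.ofReal (rankedPoint (M p.1) k) * G (p.2 k)) := by
    simp_rw [← lintegral_atomicMeasure _ _ hG]
    exact hmG.comp hm2
  rw [lintegral_map hmG hm1, lintegral_map hmG hm2]
  simp_rw [lintegral_crm _ hG, lintegral_atomicMeasure _ _ hG]
  -- The Laplace functional of `N` and the marking theorem, both at `s G(x)`, give the same double
  -- integral up to the order of integration.
  rw [hN.lintegral_expNeg hg, lintegral_prod _ h2.aemeasurable]
  have h3 := hM.lintegral_expNeg_marked hcfg η (g := fun x s => ENNReal.ofReal s * G x) hg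
  refine Eq.trans ?_ h3.symm
  rw [lintegral_prod_symm _ h1.aemeasurable]

theorem IsPoissonProcess.lintegral_prod_expNeg_marked {Ω X : Type*} [MeasurableSpace Ω]
    [MeasurableSpace X] {P : Measure Ω} [IsProbabilityMeasure P] {ρ : Measure ℝ} [SigmaFinite ρ]
    {M : Ω → Measure ℝ} (hM : IsPoissonProcess M ρ P)
    (hcfg : ∀ᵐ ω ∂P, IsPointConfiguration (M ω)) (η : Measure X) [IsProbabilityMeasure η]
    {g : X → ℝ → ℝ≥0∞} (hg : Measurable fun z : X × ℝ => g z.1 z.2) :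
    ∫⁻ p, expNeg (∑' k, g (p.2 k) (rankedPoint (M p.1) k))
      ∂(P.prod (Measure.infinitePi fun _ : ℕ => η)) =
      expNeg (∫⁻ s, ∫⁻ x, (1 - expNeg (g x s)) ∂η ∂ρ) := by
  rw [← hM.lintegral_expNeg_marked hcfg η hg]
  refine lintegral_prod _ (Measurable.aemeasurable (Measurable.expNeg (Measurable.tsum fun k => ?_)))
  have h1 : Measurable fun p : Ω × (ℕ → X) => p.2 k := by fun_prop
  have h2 : Measurable fun p : Ω × (ℕ → X) => rankedPoint (M p.1) k :=
    (measurable_rankedPoint k).comp (hM.measurable.comp measurable_fst)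
  exact hg.comp (h1.prodMk h2)

/-! ### The multivariate Mecke formula. -/

/-- Inclusion-exclusion: if the integral of products of `[0, 1]`-valued functions factorizes,
so does the integral of the products of their complements to `1`. -/
theorem lintegral_mul_prod_one_sub {α ι : Type*} [MeasurableSpace α] [DecidableEq ι]
    {μ : Measure α} {y : α → ℝ≥0∞} {x : ι → α → ℝ≥0∞} (hy : Measurable y)
    (hx : ∀ c, Measurable (x c)) (hx1 : ∀ c z, x c z ≤ 1) {L : ℝ≥0∞} {ξ : ι → ℝ≥0∞} (hL : L ≠ ∞)
    (hξ : ∀ c, ξ c ≤ 1)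
    (h : ∀ A : Finset ι, ∫⁻ z, y z * ∏ c ∈ A, x c z ∂μ = L * ∏ c ∈ A, ξ c) (B : Finset ι) :
    ∀ A : Finset ι, Disjoint A B →
      ∫⁻ z, y z * (∏ c ∈ A, x c z) * ∏ c ∈ B, (1 - x c z) ∂μ =
        L * (∏ c ∈ A, ξ c) * ∏ c ∈ B, (1 - ξ c) := by
  have hle : ∀ {u : ι → ℝ≥0∞} (A : Finset ι), (∀ c, u c ≤ 1) → ∏ c ∈ A, u c ≤ 1 :=
    fun A hu => Finset.prod_le_one' fun c _ => hu c
  have hyL : ∫⁻ z, y z ∂μ = L := by simpa using h ∅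
  -- The set `A` stays general because expanding `1 - x b` leaves one term with `A` and one with
  -- `insert b A`. Subtraction in `[0, ∞]` requires the finiteness bounds below.
  induction B using Finset.induction_on with
  | empty => intro A _; simpa using h A
  | insert b B hb ih =>
    intro A hAB
    rw [Finset.disjoint_insert_right] at hAB
    have hyle : ∀ z, y z * (∏ c ∈ A, x c z) * ∏ c ∈ B, (1 - x c z) ≤ y z := fun z => by
      rw [mul_assoc]
      refine mul_le_of_le_one_right zero_le (mul_le_one' (hle A fun c => hx1 c z)
        (hle B fun c => tsub_le_self))
    have hsplit : ∀ (a p q u : ℝ≥0∞), a * p * q ≠ ∞ →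
        a * p * ((1 - u) * q) = a * p * q - a * (u * p) * q := fun a p q u hh => by
      rw [show a * p * ((1 - u) * q) = (a * p * q) * (1 - u) by ring,
        ENNReal.mul_sub fun _ _ => hh, mul_one]
      congr 1; ring
    have hmeas : ∀ (A : Finset ι), Measurable fun z =>
        y z * (∏ c ∈ A, x c z) * ∏ c ∈ B, (1 - x c z) := fun A =>
      (hy.mul (Finset.measurable_prod _ fun c _ => hx c)).mul
        (Finset.measurable_prod _ fun c _ => (hx c).const_sub 1)
    have hAb : Disjoint (insert b A) B := by
      rw [Finset.disjoint_insert_left]; exact ⟨hb, hAB.2⟩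
    have hae : ∀ᵐ z ∂μ, y z < ∞ := ae_lt_top hy (hyL ▸ hL)
    have e1 : ∫⁻ z, y z * (∏ c ∈ A, x c z) * ∏ c ∈ insert b B, (1 - x c z) ∂μ =
        ∫⁻ z, (y z * (∏ c ∈ A, x c z) * ∏ c ∈ B, (1 - x c z) -
          y z * (∏ c ∈ insert b A, x c z) * ∏ c ∈ B, (1 - x c z)) ∂μ := by
      refine lintegral_congr_ae ?_
      filter_upwards [hae] with z hz
      rw [Finset.prod_insert hb, Finset.prod_insert hAB.1,
        hsplit _ _ _ _ ((hyle z).trans_lt hz).ne]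
    rw [e1, lintegral_sub (hmeas _), ih _ hAb, ih _ hAB.2, Finset.prod_insert hb,
      Finset.prod_insert hAB.1, hsplit]
    · refine ne_top_of_le_ne_top hL ?_
      rw [mul_assoc]
      exact mul_le_of_le_one_right zero_le (mul_le_one' (hle A hξ) (hle B fun c => tsub_le_self))
    · refine ne_top_of_le_ne_top hL ?_
      rw [ih _ hAb, mul_assoc]
      exact mul_le_of_le_one_right zero_le (mul_le_one' (hle _ hξ) (hle B fun c => tsub_le_self))
    · refine .of_forall fun z => ?_
      dsimp only
      rw [Finset.prod_insert hAB.1]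
      gcongr
      exact mul_le_of_le_one_left zero_le (hx1 b z)

/-- The difference quotients `2ⁿ (1 - exp (-x / 2ⁿ))`, which increase to `x`. -/
noncomputable def expQuotient (n : ℕ) (x : ℝ≥0∞) : ℝ≥0∞ := 2 ^ n * (1 - expNeg ((2 ^ n)⁻¹ * x))

theorem expQuotient_le (n : ℕ) (x : ℝ≥0∞) : expQuotient n x ≤ x := by
  rw [expQuotient]
  calc 2 ^ n * (1 - expNeg ((2 ^ n)⁻¹ * x)) ≤ 2 ^ n * ((2 ^ n)⁻¹ * x) := by
        gcongr; exact one_sub_expNeg_le _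
    _ = x := by rw [← mul_assoc, ENNReal.mul_inv_cancel (by simp) (by simp), one_mul]

theorem expQuotient_mono (n : ℕ) : Monotone (expQuotient n) := fun x y h => by
  unfold expQuotient
  gcongr
  exact expNeg_antitone (by gcongr)

theorem continuous_expQuotient (n : ℕ) : Continuous (expQuotient n) := by
  refine (ENNReal.continuous_const_mul (by simp)).comp ?_
  refine (ENNReal.continuous_sub_left ENNReal.one_ne_top).comp (continuous_expNeg.comp ?_)
  exact ENNReal.continuous_const_mul (by simp)

@[fun_prop]
theorem Measurable.expQuotient {α : Type*} [MeasurableSpace α] {f : α → ℝ≥0∞} (n : ℕ)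
    (hf : Measurable f) : Measurable fun x => expQuotient n (f x) :=
  (continuous_expQuotient n).measurable.comp hf

/-- Halving the step size replaces `1 - w²` by `2 (1 - w)`, and the difference is `(1 - w)²`. This
is why the steps are dyadic. -/
theorem monotone_expQuotient (x : ℝ≥0∞) : Monotone fun n => expQuotient n x := by
  refine monotone_nat_of_le_succ fun n => ?_
  unfold expQuotient
  set w := expNeg ((2 ^ (n + 1))⁻¹ * x) with hw
  have h1 : expNeg ((2 ^ n)⁻¹ * x) = w * w := by
    have h2 : (2 : ℝ≥0∞) * 2⁻¹ = 1 := ENNReal.mul_inv_cancel (by simp) (by simp)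
    rw [hw, ← expNeg_add, ← add_mul, ← two_mul, pow_succ, ENNReal.mul_inv (by simp) (by simp),
      mul_comm ((2 ^ n)⁻¹ : ℝ≥0∞) 2⁻¹, ← mul_assoc, h2, one_mul]
  have hw1 : w ≤ 1 := expNeg_le_one _
  rw [h1, pow_succ, mul_assoc]
  gcongr
  have hwt : w ≠ ∞ := expNeg_ne_top _
  clear_value w
  lift w to ℝ≥0 using hwt
  norm_cast at hw1 ⊢
  rw [← NNReal.coe_le_coe, NNReal.coe_mul, NNReal.coe_sub hw1, NNReal.coe_sub (by
    exact mul_le_one' hw1 hw1)]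
  push_cast
  nlinarith [sq_nonneg ((w : ℝ) - 1)]

theorem tendsto_expQuotient (x : ℝ≥0∞) :
    Filter.Tendsto (fun n => expQuotient n x) Filter.atTop (nhds x) := by
  rcases eq_or_ne x ∞ with rfl | hx
  · have h : ∀ n, expQuotient n ∞ = 2 ^ n := fun n => by
      rw [expQuotient, ENNReal.mul_top (by simp)]; simp
    simp_rw [h]
    exact ENNReal.tendsto_pow_atTop_nhds_top_iff.2 (by norm_num)
  · lift x to ℝ≥0 using hx
    have h : ∀ n, expQuotient n x =
        ENNReal.ofReal (2 ^ n * (1 - Real.exp (-((2 ^ n)⁻¹ * x)))) := fun n => by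
      have e : ((2 ^ n)⁻¹ * x : ℝ≥0∞) = ENNReal.ofReal ((2 ^ n)⁻¹ * x) := by
        rw [ENNReal.ofReal_mul (by positivity), ENNReal.ofReal_inv_of_pos (by positivity),
          ENNReal.ofReal_pow (by norm_num)]
        simp
      rw [expQuotient, e, expNeg_ofReal (by positivity), ENNReal.ofReal_mul (by positivity),
        ENNReal.ofReal_sub _ (Real.exp_nonneg _), ENNReal.ofReal_pow (by norm_num)]
      simp
    simp_rw [h]
    rw [← ENNReal.ofReal_coe_nnreal (p := x)]
    refine ENNReal.tendsto_ofReal ?_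
    -- The quotients are slopes at `0` of `t ↦ 1 - exp (-t x)`, whose derivative there is `x`.
    have hd : HasDerivAt (fun t : ℝ => 1 - Real.exp (-(t * x))) (x : ℝ) 0 := by
      have h1 : HasDerivAt (fun t : ℝ => -(t * x)) (-(x : ℝ)) 0 := by
        simpa using ((hasDerivAt_id (0 : ℝ)).mul_const (x : ℝ)).fun_neg
      have := (h1.exp).const_sub 1
      simpa using this
    have h2 : Filter.Tendsto (fun n : ℕ => ((2 : ℝ) ^ n)⁻¹) Filter.atTop (nhdsWithin 0 {0}ᶜ) := by
      refine tendsto_nhdsWithin_iff.2 ⟨?_, .of_forall fun n => by simp⟩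
      exact (tendsto_pow_atTop_atTop_of_one_lt (by norm_num)).inv_tendsto_atTop
    have h3 := (hasDerivAt_iff_tendsto_slope.1 hd).comp h2
    refine h3.congr fun n => ?_
    simp [slope_def_field]
    ring

/-- Order and argument move together. For a lower bound, fix an order `m` for which the quotient at
`r` is large enough, use its continuity, and then use monotonicity in the order. -/
theorem tendsto_expQuotient_of_monotone {R : ℕ → ℝ≥0∞} {r : ℝ≥0∞} (hR : Monotone R)
    (hr : Filter.Tendsto R Filter.atTop (nhds r)) :
    Filter.Tendsto (fun n => expQuotient n (R n)) Filter.atTop (nhds r) := by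
  have hle : ∀ n, R n ≤ r := hR.ge_of_tendsto hr
  refine tendsto_order.2 ⟨fun b hb => ?_, fun b hb =>
    .of_forall fun n => ((expQuotient_le n _).trans (hle n)).trans_lt hb⟩
  obtain ⟨m, hm⟩ := ((tendsto_order.1 (tendsto_expQuotient r)).1 b hb).exists
  have h1 : Filter.Tendsto (fun n => expQuotient m (R n)) Filter.atTop (nhds (expQuotient m r)) :=
    ((continuous_expQuotient m).tendsto r).comp hr
  filter_upwards [(tendsto_order.1 h1).1 b hm, Filter.eventually_ge_atTop m] with n hn hmn
  exact hn.trans_le (monotone_expQuotient (R n) hmn)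

/-- Multiplication on `[0, ∞]` is discontinuous at `(0, ∞)`. Monotonicity removes this case: a
factor with limit `0` is identically `0`. -/
theorem ENNReal.tendsto_finset_prod_of_monotone {ι : Type*} {u : ι → ℕ → ℝ≥0∞} {U : ι → ℝ≥0∞}
    (hu : ∀ c, Monotone (u c)) (hU : ∀ c, Filter.Tendsto (u c) Filter.atTop (nhds (U c)))
    (s : Finset ι) :
    Filter.Tendsto (fun n => ∏ c ∈ s, u c n) Filter.atTop (nhds (∏ c ∈ s, U c)) := by
  by_cases h0 : ∃ c ∈ s, U c = 0
  · obtain ⟨c, hc, hc0⟩ := h0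
    have hz : ∀ n, u c n = 0 := fun n =>
      le_antisymm (hc0 ▸ (hu c).ge_of_tendsto (hU c) n) zero_le
    rw [Finset.prod_eq_zero hc hc0]
    exact tendsto_const_nhds.congr fun n => (Finset.prod_eq_zero hc (hz n)).symm
  · push Not at h0
    induction s using Finset.cons_induction with
    | empty => simp
    | cons c s hc ih =>
      simp_rw [Finset.prod_cons]
      refine ENNReal.Tendsto.mul (hU c) (.inl (h0 c (Finset.mem_cons_self c s)))
        (ih fun d hd => h0 d (Finset.mem_cons_of_mem hd)) (.inl ?_)
      exact Finset.prod_ne_zero_iff.2 fun d hd => h0 d (Finset.mem_cons_of_mem hd)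

theorem one_sub_mul_eq {l e : ℝ≥0∞} (hl : l ≤ 1) (he : e ≤ 1) :
    1 - l * e = (1 - l) + l * (1 - e) := by
  have hlt : l ≠ ∞ := (hl.trans_lt ENNReal.one_lt_top).ne
  have hle : l * e ≠ ∞ := ((mul_le_one' hl he).trans_lt ENNReal.one_lt_top).ne
  rw [ENNReal.mul_sub fun _ _ => hlt, mul_one]
  exact (tsub_add_tsub_cancel hl (mul_le_of_le_one_right zero_le he)).symm

/-- At most one of the disjoint sets contains `x`, so the sum has at most one nonzero term. The
exponent thereby becomes additive in `c`. -/
theorem one_sub_expNeg_add_sum {X ι : Type*} (B : ι → Set X)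
    (hB : Pairwise fun c d => Disjoint (B c) (B d)) (A : Finset ι) (l : ℝ≥0∞) (b : ι → ℝ≥0∞)
    (x : X) :
    1 - expNeg (l + ∑ c ∈ A, (B c).indicator 1 x * b c) =
      (1 - expNeg l) + ∑ c ∈ A, (B c).indicator 1 x * (expNeg l * (1 - expNeg (b c))) := by
  by_cases h : ∃ c ∈ A, x ∈ B c
  · obtain ⟨c, hc, hx⟩ := h
    have h0 : ∀ d ∈ A, d ≠ c → (B d).indicator (1 : X → ℝ≥0∞) x = 0 := fun d _ hd =>
      indicator_of_notMem (fun hxd => (hB hd).le_bot ⟨hxd, hx⟩) _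
    rw [Finset.sum_eq_single c (fun d hd hne => by rw [h0 d hd hne, zero_mul])
        (fun hcc => absurd hc hcc),
      Finset.sum_eq_single c (fun d hd hne => by rw [h0 d hd hne, zero_mul])
        (fun hcc => absurd hc hcc), indicator_of_mem hx, Pi.one_apply, one_mul, one_mul,
      expNeg_add, one_sub_mul_eq (expNeg_le_one _) (expNeg_le_one _)]
  · push Not at h
    rw [Finset.sum_eq_zero fun c hc => by rw [indicator_of_notMem (h c hc), zero_mul],
      Finset.sum_eq_zero fun c hc => by rw [indicator_of_notMem (h c hc), zero_mul], add_zero,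
      add_zero]

section
variable {Ω X ι : Type*} [MeasurableSpace Ω] [MeasurableSpace X]
  {P : Measure Ω} [IsProbabilityMeasure P] {ρ : Measure ℝ} [SigmaFinite ρ] {M : Ω → Measure ℝ}

theorem measurable_tsum_marked (hM : Measurable M) {g : X → ℝ → ℝ≥0∞}
    (hg : Measurable fun z : X × ℝ => g z.1 z.2) :
    Measurable fun p : Ω × (ℕ → X) => ∑' k, g (p.2 k) (rankedPoint (M p.1) k) := by
  refine Measurable.tsum fun k => ?_
  have h1 : Measurable fun p : Ω × (ℕ → X) => p.2 k := by fun_prop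
  have h2 : Measurable fun p : Ω × (ℕ → X) => rankedPoint (M p.1) k :=
    (measurable_rankedPoint k).comp (hM.comp measurable_fst)
  exact hg.comp (h1.prodMk h2)

theorem measurable_indicator_mul {B : Set X} (hB : MeasurableSet B) {a : ℝ → ℝ≥0∞}
    (ha : Measurable a) : Measurable fun z : X × ℝ => B.indicator 1 z.1 * a z.2 :=
  ((measurable_one.indicator hB).comp measurable_fst).mul (ha.comp measurable_snd)

/-- All exponents combine into one function of mark and point. Its Laplace exponent is additive over
the disjoint sets `B c`, which expresses the independence of the points with marks in different
sets. -/
theorem IsPoissonProcess.lintegral_expNeg_mul_prod_expNeg (hM : IsPoissonProcess M ρ P)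
    (hcfg : ∀ᵐ ω ∂P, IsPointConfiguration (M ω)) (θ : Measure X) [IsProbabilityMeasure θ]
    {B : ι → Set X} (hB : Pairwise fun c d => Disjoint (B c) (B d))
    (hBm : ∀ c, MeasurableSet (B c)) {a : ι → ℝ → ℝ≥0∞} (ha : ∀ c, Measurable (a c))
    (t ε : ℝ≥0∞) (A : Finset ι) :
    ∫⁻ p, expNeg (t * ∑' k, ENNReal.ofReal (rankedPoint (M p.1) k)) *
        ∏ c ∈ A, expNeg (ε * ∑' k, (B c).indicator 1 (p.2 k) * a c (rankedPoint (M p.1) k))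
      ∂(P.prod (Measure.infinitePi fun _ : ℕ => θ)) =
      expNeg (∫⁻ s, (1 - expNeg (t * ENNReal.ofReal s)) ∂ρ) *
        ∏ c ∈ A, expNeg (θ (B c) * ∫⁻ s, expNeg (t * ENNReal.ofReal s) *
          (1 - expNeg (ε * a c s)) ∂ρ) := by
  have hind : ∀ c, Measurable ((B c).indicator (1 : X → ℝ≥0∞)) := fun c =>
    measurable_one.indicator (hBm c)
  let g : X → ℝ → ℝ≥0∞ := fun x s =>
    t * ENNReal.ofReal s + ∑ c ∈ A, (B c).indicator 1 x * (ε * a c s)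
  have hg : Measurable fun z : X × ℝ => g z.1 z.2 := by
    refine Measurable.add (by fun_prop) (Finset.measurable_sum _ fun c _ => ?_)
    exact measurable_indicator_mul (hBm c) ((ha c).const_mul ε)
  have h1 : ∀ p : Ω × (ℕ → X), expNeg (t * ∑' k, ENNReal.ofReal (rankedPoint (M p.1) k)) *
      ∏ c ∈ A, expNeg (ε * ∑' k, (B c).indicator 1 (p.2 k) * a c (rankedPoint (M p.1) k)) =
      expNeg (∑' k, g (p.2 k) (rankedPoint (M p.1) k)) := fun p => by
    rw [← expNeg_sum, ← expNeg_add, ENNReal.tsum_add, ENNReal.tsum_mul_left,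
      Summable.tsum_finsetSum fun _ _ => ENNReal.summable]
    congr 3
    ext c
    rw [← ENNReal.tsum_mul_left]
    refine tsum_congr fun k => ?_
    ring
  have hw : ∀ c, Measurable fun s => expNeg (t * ENNReal.ofReal s) * (1 - expNeg (ε * a c s)) :=
    fun c => by have := ha c; fun_prop
  have h2 : ∀ s, ∫⁻ x, (1 - expNeg (g x s)) ∂θ = (1 - expNeg (t * ENNReal.ofReal s)) +
      ∑ c ∈ A, θ (B c) * (expNeg (t * ENNReal.ofReal s) * (1 - expNeg (ε * a c s))) := fun s => by
    simp_rw [g, one_sub_expNeg_add_sum B hB]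
    rw [lintegral_add_left measurable_const, lintegral_finsetSum _ fun c _ => (hind c).mul_const _]
    simp_rw [lintegral_mul_const _ (hind _), lintegral_indicator_one (hBm _)]
    simp
  simp_rw [h1]
  rw [hM.lintegral_prod_expNeg_marked hcfg θ hg]
  simp_rw [h2]
  rw [lintegral_add_left (by fun_prop), lintegral_finsetSum _ fun c _ => (hw c).const_mul _,
    expNeg_add, expNeg_sum]
  simp_rw [lintegral_const_mul _ (hw _)]

/-- A first derivative in each of the exponents at `0`, taken through monotone difference quotients
so that no integrability is required. -/
theorem IsPoissonProcess.lintegral_expNeg_mul_prod_tsum [Fintype ι]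
    (hM : IsPoissonProcess M ρ P)
    (hcfg : ∀ᵐ ω ∂P, IsPointConfiguration (M ω)) (θ : Measure X) [IsProbabilityMeasure θ]
    {B : ι → Set X} (hB : Pairwise fun c d => Disjoint (B c) (B d))
    (hBm : ∀ c, MeasurableSet (B c)) {a : ι → ℝ → ℝ≥0∞} (ha : ∀ c, Measurable (a c)) (t : ℝ≥0∞) :
    ∫⁻ p, expNeg (t * ∑' k, ENNReal.ofReal (rankedPoint (M p.1) k)) *
        ∏ c, ∑' k, (B c).indicator 1 (p.2 k) * a c (rankedPoint (M p.1) k)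
      ∂(P.prod (Measure.infinitePi fun _ : ℕ => θ)) =
      expNeg (∫⁻ s, (1 - expNeg (t * ENNReal.ofReal s)) ∂ρ) *
        ∏ c, θ (B c) * ∫⁻ s, expNeg (t * ENNReal.ofReal s) * a c s ∂ρ := by
  classical
  let S : ι → Ω × (ℕ → X) → ℝ≥0∞ := fun c p =>
    ∑' k, (B c).indicator 1 (p.2 k) * a c (rankedPoint (M p.1) k)
  let y : Ω × (ℕ → X) → ℝ≥0∞ := fun p =>
    expNeg (t * ∑' k, ENNReal.ofReal (rankedPoint (M p.1) k))
  have hS : ∀ c, Measurable (S c) := fun c =>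
    measurable_tsum_marked (g := fun x s => (B c).indicator 1 x * a c s) hM.measurable
      (measurable_indicator_mul (hBm c) (ha c))
  have hy : Measurable y := by
    have := measurable_tsum_marked (M := M) (X := X) (g := fun _ s => ENNReal.ofReal s)
      hM.measurable (by fun_prop)
    exact (this.const_mul t).expNeg
  set L := expNeg (∫⁻ s, (1 - expNeg (t * ENNReal.ofReal s)) ∂ρ)
  -- Scaled so that the exponent of the factor `c` at `ε = 2⁻ⁿ` is `2⁻ⁿ R c n`; the right side is
  -- then again made of quotients of order `n`.
  let R : ι → ℕ → ℝ≥0∞ := fun c n =>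
    θ (B c) * ∫⁻ s, expNeg (t * ENNReal.ofReal s) * expQuotient n (a c s) ∂ρ
  have hstep : ∀ n : ℕ, ∫⁻ p, y p * ∏ c, expQuotient n (S c p)
      ∂(P.prod (Measure.infinitePi fun _ : ℕ => θ)) = L * ∏ c, expQuotient n (R c n) := by
    intro n
    have h1 := lintegral_mul_prod_one_sub (μ := P.prod (Measure.infinitePi fun _ : ℕ => θ))
      (y := y) (x := fun c p => expNeg ((2 ^ n)⁻¹ * S c p)) hy
      (fun c => ((hS c).const_mul _).expNeg) (fun c p => expNeg_le_one _) (expNeg_ne_top _)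
      (fun c => expNeg_le_one _)
      (hM.lintegral_expNeg_mul_prod_expNeg hcfg θ hB hBm ha t (2 ^ n)⁻¹) Finset.univ ∅
      (Finset.disjoint_empty_left _)
    simp only [Finset.prod_empty, mul_one] at h1
    have hR : ∀ c, (2 ^ n)⁻¹ * R c n = θ (B c) * ∫⁻ s, expNeg (t * ENNReal.ofReal s) *
          (1 - expNeg ((2 ^ n)⁻¹ * a c s)) ∂ρ := fun c => by
      have hm : Measurable fun s =>
          expNeg (t * ENNReal.ofReal s) * (1 - expNeg ((2 ^ n)⁻¹ * a c s)) := by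
        have := ha c; fun_prop
      have e : ∫⁻ s, expNeg (t * ENNReal.ofReal s) * expQuotient n (a c s) ∂ρ =
          2 ^ n * ∫⁻ s, expNeg (t * ENNReal.ofReal s) * (1 - expNeg ((2 ^ n)⁻¹ * a c s)) ∂ρ := by
        rw [← lintegral_const_mul _ hm]
        refine lintegral_congr fun s => ?_
        rw [expQuotient]; ring
      simp only [R, e]
      rw [mul_left_comm (θ (B c)), ← mul_assoc, ENNReal.inv_mul_cancel (by simp) (by simp),
        one_mul]
    simp only [expQuotient, Finset.prod_mul_distrib, Finset.prod_const, hR]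
    rw [mul_left_comm, ← h1, ← lintegral_const_mul]
    · refine lintegral_congr fun p => ?_
      ring
    · exact hy.mul (Finset.measurable_prod _ fun c _ => ((hS c).const_mul _).expNeg.const_sub 1)
  have hlimR : ∀ c, Monotone (R c) ∧ Filter.Tendsto (R c) Filter.atTop
      (nhds (θ (B c) * ∫⁻ s, expNeg (t * ENNReal.ofReal s) * a c s ∂ρ)) := fun c => by
    have hmono : ∀ s, Monotone fun n => expNeg (t * ENNReal.ofReal s) * expQuotient n (a c s) :=
      fun s i j hij => mul_le_mul_right (monotone_expQuotient _ hij) _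
    refine ⟨fun i j hij => mul_le_mul_right (lintegral_mono fun s => hmono s hij) _, ?_⟩
    refine ENNReal.Tendsto.const_mul ?_ (.inr (measure_ne_top θ _))
    refine lintegral_tendsto_of_tendsto_of_monotone (fun n => ?_) (.of_forall hmono)
      (.of_forall fun s => ?_)
    · have := ha c; fun_prop
    · exact ENNReal.Tendsto.const_mul (tendsto_expQuotient _) (.inr (expNeg_ne_top _))
  have hL : Filter.Tendsto (fun n => ∫⁻ p, y p * ∏ c, expQuotient n (S c p)
      ∂(P.prod (Measure.infinitePi fun _ : ℕ => θ))) Filter.atTop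
      (nhds (∫⁻ p, y p * ∏ c, S c p ∂(P.prod (Measure.infinitePi fun _ : ℕ => θ)))) := by
    refine lintegral_tendsto_of_tendsto_of_monotone (fun n => ?_) (.of_forall fun p i j hij => ?_)
      (.of_forall fun p => ?_)
    · exact (hy.mul (Finset.measurable_prod _ fun c _ => (hS c).expQuotient n)).aemeasurable
    · exact mul_le_mul_right (Finset.prod_le_prod' fun c _ => monotone_expQuotient _ hij) _
    · exact ENNReal.Tendsto.const_mul (ENNReal.tendsto_finset_prod_of_monotone
        (fun c => monotone_expQuotient _) (fun c => tendsto_expQuotient _) _)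
        (.inr (expNeg_ne_top _))
  refine tendsto_nhds_unique hL ?_
  simp_rw [hstep]
  refine ENNReal.Tendsto.const_mul (ENNReal.tendsto_finset_prod_of_monotone (fun c => ?_)
    (fun c => tendsto_expQuotient_of_monotone (hlimR c).1 (hlimR c).2) _) (.inr (expNeg_ne_top _))
  exact fun i j hij => (monotone_expQuotient _ hij).trans (expQuotient_mono _ ((hlimR c).1 hij))

end

/-- The sum of `∏ u c (e c)` over the injective families `e` of indices. -/
noncomputable def distinctSum {ι : Type*} [Fintype ι] (u : ι → ℕ → ℝ≥0∞) : ℝ≥0∞ :=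
  ∑' e : ι → ℕ, {e : ι → ℕ | Function.Injective e}.indicator (fun e => ∏ c, u c (e c)) e

/-- After the product is expanded, distinct indices carry independent marks. A repeated index would
put one mark in two disjoint sets and contributes `0`. -/
theorem lintegral_prod_tsum_infinitePi {X ι : Type*} [MeasurableSpace X] [Fintype ι]
    (θ : Measure X) [IsProbabilityMeasure θ] {B : ι → Set X}
    (hB : Pairwise fun c d => Disjoint (B c) (B d)) (hBm : ∀ c, MeasurableSet (B c))
    (u : ι → ℕ → ℝ≥0∞) :
    ∫⁻ z, ∏ c, ∑' k, (B c).indicator 1 (z k) * u c k ∂(Measure.infinitePi fun _ : ℕ => θ) =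
      (∏ c, θ (B c)) * distinctSum u := by
  have hind : ∀ c, Measurable ((B c).indicator (1 : X → ℝ≥0∞)) := fun c =>
    measurable_one.indicator (hBm c)
  have hmc : ∀ c k, Measurable fun z : ℕ → X => (B c).indicator (1 : X → ℝ≥0∞) (z k) :=
    fun c k => (hind c).comp (measurable_pi_apply k)
  simp_rw [ENNReal.prod_tsum]
  rw [lintegral_tsum fun e => (Finset.measurable_prod _ fun c _ =>
    (hmc c (e c)).mul_const _).aemeasurable, distinctSum, ← ENNReal.tsum_mul_left]
  refine tsum_congr fun e => ?_
  simp_rw [Finset.prod_mul_distrib]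
  rw [lintegral_mul_const _ (Finset.measurable_prod _ fun c _ => hmc c (e c))]
  by_cases he : Function.Injective e
  · rw [indicator_of_mem (by exact he)]
    congr 1
    have hi := ((iIndepFun_infinitePi (P := fun _ : ℕ => θ) (X := fun _ x => x)
      fun k => measurable_id).precomp he).comp (fun c => (B c).indicator (1 : X → ℝ≥0∞)) hind
    refine (lintegral_prod_eq_prod_lintegral_of_indepFun Finset.univ _ hi
      fun c => hmc c (e c)).trans (Finset.prod_congr rfl fun c _ => ?_)
    rw [← lintegral_indicator_one (hBm c)]
    exact (measurePreserving_eval_infinitePi (fun _ : ℕ => θ) (e c)).lintegral_comp (hind c)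
  · rw [indicator_of_notMem (by exact he), mul_zero]
    have : ∀ z : ℕ → X, ∏ c, (B c).indicator (1 : X → ℝ≥0∞) (z (e c)) = 0 := fun z => by
      simp only [Function.Injective, not_forall] at he
      obtain ⟨c, d, hcd, hne⟩ := he
      by_contra h0
      rw [Finset.prod_eq_zero_iff] at h0
      push Not at h0
      have h1 := h0 c (Finset.mem_univ _)
      have h2 := h0 d (Finset.mem_univ _)
      simp only [ne_eq, indicator_apply_eq_zero, not_forall] at h1 h2
      exact (hB hne).le_bot ⟨h1.1, hcd ▸ h2.1⟩
    simp [this]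

theorem measurable_distinctSum {α ι : Type*} [Fintype ι] [MeasurableSpace α]
    {u : α → ι → ℕ → ℝ≥0∞} (hu : ∀ c k, Measurable fun x => u x c k) :
    Measurable fun x => distinctSum (u x) := by
  refine Measurable.tsum fun e => ?_
  by_cases he : Function.Injective e
  · simp only [indicator_of_mem (show e ∈ {e : ι → ℕ | Function.Injective e} from he)]
    exact Finset.measurable_prod _ fun c _ => hu _ _
  · simp only [indicator_of_notMem (show e ∉ {e : ι → ℕ | Function.Injective e} from he)]
    exact measurable_const

/-- The Laplace form of the multivariate Mecke formula. -/
theorem IsPoissonProcess.lintegral_expNeg_mul_distinctSum {Ω ι : Type*} [MeasurableSpace Ω]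
    [Fintype ι] {P : Measure Ω} [IsProbabilityMeasure P] {ρ : Measure ℝ} [SigmaFinite ρ]
    {M : Ω → Measure ℝ} (hM : IsPoissonProcess M ρ P)
    (hcfg : ∀ᵐ ω ∂P, IsPointConfiguration (M ω)) {a : ι → ℝ → ℝ≥0∞} (ha : ∀ c, Measurable (a c))
    (t : ℝ≥0∞) :
    ∫⁻ ω, expNeg (t * ∑' k, ENNReal.ofReal (rankedPoint (M ω) k)) *
        distinctSum (fun c k => a c (rankedPoint (M ω) k)) ∂P =
      (∫⁻ ω, expNeg (t * ∑' k, ENNReal.ofReal (rankedPoint (M ω) k)) ∂P) *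
        ∏ c, ∫⁻ s, expNeg (t * ENNReal.ofReal s) * a c s ∂ρ := by
  -- The marks are auxiliary. Any law on `ℕ` that charges every singleton serves, since the factor
  -- `∏ θ (B c)` is cancelled at the end.
  let θ : Measure ℕ := poissonMeasure 1
  let B : ι → Set ℕ := fun c => {(Fintype.equivFin ι c : ℕ)}
  have hB : Pairwise fun c d => Disjoint (B c) (B d) := fun c d hcd => by
    refine disjoint_singleton.2 ?_
    exact fun h => hcd ((Fintype.equivFin ι).injective (Fin.ext h))
  have hBm : ∀ c, MeasurableSet (B c) := fun c => measurableSet_singleton _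
  have hθ : ∀ c, θ (B c) ≠ 0 := fun c => by
    simp only [θ, B, poissonMeasure_singleton]
    exact (ENNReal.ofReal_pos.2 (by positivity)).ne'
  have hJ : ∀ k, Measurable fun ω => rankedPoint (M ω) k := fun k =>
    (measurable_rankedPoint k).comp hM.measurable
  have hT : Measurable fun ω => expNeg (t * ∑' k, ENNReal.ofReal (rankedPoint (M ω) k)) :=
    ((Measurable.tsum fun k => (hJ k).ennreal_ofReal).const_mul t).expNeg
  have h1 := hM.lintegral_expNeg_mul_prod_tsum hcfg θ hB hBm ha t
  have h0 : ∫⁻ ω, expNeg (t * ∑' k, ENNReal.ofReal (rankedPoint (M ω) k)) ∂P =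
      expNeg (∫⁻ s, (1 - expNeg (t * ENNReal.ofReal s)) ∂ρ) := by
    rw [← hM.lintegral_expNeg (g := fun s => t * ENNReal.ofReal s) (by fun_prop)]
    refine lintegral_congr_ae ?_
    filter_upwards [hcfg] with ω hω
    rw [hω.lintegral_eq_tsum (by fun_prop), ENNReal.tsum_mul_left]
  have hSm : Measurable fun p : Ω × (ℕ → ℕ) =>
      expNeg (t * ∑' k, ENNReal.ofReal (rankedPoint (M p.1) k)) *
        ∏ c, ∑' k, (B c).indicator 1 (p.2 k) * a c (rankedPoint (M p.1) k) :=
    (hT.comp measurable_fst).mul (Finset.measurable_prod _ fun c _ =>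
      measurable_tsum_marked (g := fun x s => (B c).indicator 1 x * a c s) hM.measurable
        (measurable_indicator_mul (hBm c) (ha c)))
  have hinner : ∀ ω, Measurable fun z : ℕ → ℕ =>
      ∏ c, ∑' k, (B c).indicator (1 : ℕ → ℝ≥0∞) (z k) * a c (rankedPoint (M ω) k) := fun ω =>
    Finset.measurable_prod _ fun c _ => Measurable.tsum fun k =>
      ((measurable_of_countable ((B c).indicator (1 : ℕ → ℝ≥0∞))).comp
        (measurable_pi_apply k)).mul_const _
  have hD : Measurable fun ω => expNeg (t * ∑' k, ENNReal.ofReal (rankedPoint (M ω) k)) *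
      distinctSum (fun c k => a c (rankedPoint (M ω) k)) :=
    hT.mul (measurable_distinctSum fun c k => (ha c).comp (hJ k))
  rw [lintegral_prod _ hSm.aemeasurable] at h1
  simp_rw [lintegral_const_mul _ (hinner _), lintegral_prod_tsum_infinitePi θ hB hBm,
    mul_left_comm _ (∏ c, θ (B c)) _] at h1
  rw [lintegral_const_mul _ hD, Finset.prod_mul_distrib, mul_left_comm, ← h0] at h1
  exact (ENNReal.mul_right_inj (Finset.prod_ne_zero_iff.2 fun c _ => hθ c)
    (ENNReal.prod_ne_top fun c _ => measure_ne_top θ _)).1 h1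

/-- A finite measure on `[0, ∞]` is determined by its Laplace transform at the natural numbers. -/
theorem ext_of_laplaceTransform {μ₁ μ₂ : Measure ℝ≥0∞} [IsFiniteMeasure μ₁] [IsFiniteMeasure μ₂]
    (h : ∀ n : ℕ, ∫⁻ x, expNeg (n * x) ∂μ₁ = ∫⁻ x, expNeg (n * x) ∂μ₂) : μ₁ = μ₂ := by
  refine ext_of_lintegral_expNeg (κ := Unit) (fun _ x => x) (fun _ => measurable_id) ?_ ?_
  · rw [iSup_const]
    exact MeasurableSpace.comap_id.symm
  · intro s n
    have e : ∀ x : ℝ≥0∞, ∑ i, (n i : ℝ≥0∞) * x = ((∑ i, n i : ℕ) : ℝ≥0∞) * x := fun x => by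
      rw [Nat.cast_sum, Finset.sum_mul]
    simp_rw [e]
    exact h _

section
variable {Ω ι : Type*} [MeasurableSpace Ω] [Fintype ι] {P : Measure Ω} [IsProbabilityMeasure P]
  {ρ : Measure ℝ} [SigmaFinite ρ] {M : Ω → Measure ℝ}

/-- The sum of the ranked points, as a number in `[0, ∞]`. -/
noncomputable def rankedSum (m : Measure ℝ) : ℝ≥0∞ := ∑' k, ENNReal.ofReal (rankedPoint m k)

theorem measurable_rankedSum : Measurable rankedSum :=
  Measurable.tsum fun k => (measurable_rankedPoint k).ennreal_ofReal

/-- The multivariate Mecke formula for functionals that depend on the points of the process only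
through their sum. -/
theorem IsPoissonProcess.lintegral_comp_rankedSum_mul_distinctSum
    (hM : IsPoissonProcess M ρ P)
    (hcfg : ∀ᵐ ω ∂P, IsPointConfiguration (M ω)) {a : ι → ℝ → ℝ≥0∞} (ha : ∀ c, Measurable (a c))
    (hT : ∀ᵐ ω ∂P, rankedSum (M ω) < ∞)
    (hfin : ∫⁻ ω, expNeg (rankedSum (M ω)) *
      distinctSum (fun c k => a c (rankedPoint (M ω) k)) ∂P ≠ ∞)
    {φ : ℝ≥0∞ → ℝ≥0∞} (hφ : Measurable φ) :
    ∫⁻ ω, φ (rankedSum (M ω)) * distinctSum (fun c k => a c (rankedPoint (M ω) k)) ∂P =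
      ∫⁻ s : ι → ℝ, (∏ c, a c (s c)) *
        ∫⁻ ω, φ (rankedSum (M ω) + ∑ c, ENNReal.ofReal (s c)) ∂P
        ∂(Measure.pi fun _ : ι => ρ) := by
  let T : Ω → ℝ≥0∞ := fun ω => rankedSum (M ω)
  let Ψ : Ω → ℝ≥0∞ := fun ω => distinctSum (fun c k => a c (rankedPoint (M ω) k))
  let U : (ι → ℝ) × Ω → ℝ≥0∞ := fun p => T p.2 + ∑ c, ENNReal.ofReal (p.1 c)
  let α : (ι → ℝ) → ℝ≥0∞ := fun s => ∏ c, a c (s c)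
  have hTm : Measurable T := measurable_rankedSum.comp hM.measurable
  have hΨm : Measurable Ψ := measurable_distinctSum fun c k =>
    (ha c).comp ((measurable_rankedPoint k).comp hM.measurable)
  have hUm : Measurable U := (hTm.comp measurable_snd).add
    (Finset.measurable_sum _ fun c _ => by fun_prop)
  have hαm : Measurable α := Finset.measurable_prod _ fun c _ =>
    (ha c).comp (measurable_pi_apply c)
  -- The factor `expNeg` makes both measures finite, so Laplace uniqueness applies. Their transforms
  -- at `n` are the two sides of the Laplace form of the formula at `n + 1`.
  let m₁ : Measure ℝ≥0∞ := (P.withDensity fun ω => expNeg (T ω) * Ψ ω).map T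
  let m₂ : Measure ℝ≥0∞ := (((Measure.pi fun _ : ι => ρ).prod P).withDensity
    fun p => expNeg (U p) * α p.1).map U
  have h₁ : ∀ g : ℝ≥0∞ → ℝ≥0∞, Measurable g →
      ∫⁻ x, g x ∂m₁ = ∫⁻ ω, expNeg (T ω) * Ψ ω * g (T ω) ∂P := fun g hg => by
    rw [lintegral_map hg hTm]
    exact lintegral_withDensity_eq_lintegral_mul _ (hTm.expNeg.mul hΨm) (hg.comp hTm)
  have h₂ : ∀ g : ℝ≥0∞ → ℝ≥0∞, Measurable g →
      ∫⁻ x, g x ∂m₂ = ∫⁻ s, ∫⁻ ω, expNeg (U (s, ω)) * α s * g (U (s, ω)) ∂P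
        ∂(Measure.pi fun _ : ι => ρ) := fun g hg => by
    have hm : Measurable fun p : (ι → ℝ) × Ω => expNeg (U p) * α p.1 :=
      hUm.expNeg.mul (hαm.comp measurable_fst)
    rw [lintegral_map hg hUm]
    refine (lintegral_withDensity_eq_lintegral_mul _ hm (hg.comp hUm)).trans ?_
    exact lintegral_prod _ (hm.mul (hg.comp hUm)).aemeasurable
  have hpow : ∀ (n : ℕ) (x : ℝ≥0∞), expNeg x * expNeg (n * x) = expNeg ((n + 1 : ℝ≥0∞) * x) :=
    fun n x => by rw [← expNeg_add]; congr 1; ring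
  have hlap : ∀ n : ℕ, ∫⁻ x, expNeg (n * x) ∂m₁ = ∫⁻ x, expNeg (n * x) ∂m₂ := by
    intro n
    rw [h₁ _ (by fun_prop), h₂ _ (by fun_prop)]
    have e1 : ∀ ω, expNeg (T ω) * Ψ ω * expNeg (n * T ω) =
        expNeg ((n + 1 : ℝ≥0∞) * T ω) * Ψ ω := fun ω => by rw [← hpow]; ring
    have e2 : ∀ s ω, expNeg (U (s, ω)) * α s * expNeg (n * U (s, ω)) =
        (∏ c, expNeg ((n + 1 : ℝ≥0∞) * ENNReal.ofReal (s c)) * a c (s c)) *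
          expNeg ((n + 1 : ℝ≥0∞) * T ω) := fun s ω => by
      rw [mul_right_comm, hpow, Finset.prod_mul_distrib, ← expNeg_sum, ← Finset.mul_sum,
        mul_right_comm, ← expNeg_add, ← mul_add, add_comm (∑ c, _)]
    have hTn : Measurable fun ω => expNeg ((n + 1 : ℝ≥0∞) * T ω) := (hTm.const_mul _).expNeg
    have hfm : ∀ c, Measurable fun s : ℝ =>
        expNeg ((n + 1 : ℝ≥0∞) * ENNReal.ofReal s) * a c s := fun c => by
      have := ha c; fun_prop
    simp_rw [e1, e2, lintegral_const_mul _ hTn]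
    have hpm : Measurable fun s : ι → ℝ =>
        ∏ c, expNeg ((n + 1 : ℝ≥0∞) * ENNReal.ofReal (s c)) * a c (s c) :=
      Finset.measurable_prod _ fun c _ => (hfm c).comp (measurable_pi_apply c)
    rw [lintegral_mul_const _ hpm,
      lintegral_pi_prod ρ (fun c s => expNeg ((n + 1 : ℝ≥0∞) * ENNReal.ofReal s) * a c s) hfm]
    exact (hM.lintegral_expNeg_mul_distinctSum hcfg ha (n + 1)).trans (mul_comm _ _)
  have hm₁ : m₁ univ < ∞ := by
    have := h₁ (fun _ => 1) measurable_const
    simp only [lintegral_one, mul_one] at this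
    rw [this]
    exact lt_top_iff_ne_top.2 hfin
  have hm₂ : m₂ univ < ∞ := by
    have := hlap 0
    simp only [Nat.cast_zero, zero_mul, expNeg_zero, lintegral_one] at this
    rwa [← this]
  have : IsFiniteMeasure m₁ := ⟨hm₁⟩
  have : IsFiniteMeasure m₂ := ⟨hm₂⟩
  have hm : m₁ = m₂ := ext_of_laplaceTransform hlap
  -- Testing against `φ / expNeg` removes the damping, which is legitimate because the sum is almost
  -- surely finite.
  have hgm : Measurable fun x => φ x * (expNeg x)⁻¹ := hφ.mul measurable_expNeg.inv
  have hcancel : ∀ x b, x ≠ ∞ → expNeg x * b * (φ x * (expNeg x)⁻¹) = φ x * b := fun x b hx => by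
    rw [show expNeg x * b * (φ x * (expNeg x)⁻¹) = (expNeg x * (expNeg x)⁻¹) * (φ x * b) by ring,
      ENNReal.mul_inv_cancel (expNeg_pos hx) (expNeg_ne_top x), one_mul]
  calc ∫⁻ ω, φ (T ω) * Ψ ω ∂P = ∫⁻ x, φ x * (expNeg x)⁻¹ ∂m₁ := by
        rw [h₁ _ hgm]
        refine lintegral_congr_ae ?_
        filter_upwards [hT] with ω hω using (hcancel _ _ hω.ne).symm
    _ = ∫⁻ x, φ x * (expNeg x)⁻¹ ∂m₂ := by rw [hm]
    _ = _ := by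
        rw [h₂ _ hgm]
        refine lintegral_congr fun s => ?_
        have hφU : Measurable fun ω => φ (U (s, ω)) :=
          hφ.comp (hUm.comp measurable_prodMk_left)
        rw [← lintegral_const_mul _ hφU]
        refine lintegral_congr_ae ?_
        filter_upwards [hT] with ω hω
        rw [hcancel _ _ (ENNReal.add_ne_top.2 ⟨hω.ne, ENNReal.sum_ne_top.2 fun c _ =>
          ENNReal.ofReal_ne_top⟩), mul_comm]
end

/-! ### Consequences of the conditions on the intensity. -/

theorem IsCRMIntensity.measure_singleton {X : Type*} [MetricSpace X] [MeasurableSpace X]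
    {η : Measure X} {ρ : Measure ℝ} [SigmaFinite ρ] (hν : IsCRMIntensity (η.prod ρ))
    (hρ : ρ univ ≠ 0) (x : X) : η {x} = 0 := by
  have := hν.noFixedAtom x
  rw [Measure.prod_prod] at this
  exact (mul_eq_zero.1 this).resolve_right hρ

section Intensity
variable {X : Type*} [MetricSpace X] [MeasurableSpace X] {η : Measure X} [IsProbabilityMeasure η]
  {ρ : Measure ℝ} [SigmaFinite ρ]

theorem IsCRMIntensity.measure_Iic (hν : IsCRMIntensity (η.prod ρ)) : ρ (Iic 0) = 0 := by
  have := hν.support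
  rwa [Measure.prod_prod, measure_univ, one_mul] at this

/-- Some ball has positive `η`-measure, and the truncated integrand equals `x` on its product with
`(x, ∞)`, so an infinite tail would contradict the integrability. -/
theorem IsCRMIntensity.measure_Ioi_lt_top [BorelSpace X] (hν : IsCRMIntensity (η.prod ρ)) {x : ℝ}
    (hx : 0 < x) : ρ (Ioi x) < ∞ := by
  obtain ⟨x₀⟩ : Nonempty X := nonempty_of_isProbabilityMeasure η
  obtain ⟨n, hn⟩ : ∃ n : ℕ, η (Metric.ball x₀ n) ≠ 0 := by
    by_contra! hcon
    have : η (⋃ n : ℕ, Metric.ball x₀ n) = 0 := measure_iUnion_null hcon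
    rw [Metric.iUnion_ball_nat, measure_univ] at this
    exact one_ne_zero this
  have h1 := hν.boundedlyFinite _ (Metric.isOpen_ball (x := x₀) (ε := n)).measurableSet
    Metric.isBounded_ball x hx
  have h2 : ENNReal.ofReal x * (η (Metric.ball x₀ n) * ρ (Ioi x)) ≤
      ∫⁻ z in Metric.ball x₀ n ×ˢ univ, ENNReal.ofReal (min z.2 x) ∂(η.prod ρ) := by
    rw [← Measure.prod_prod, ← setLIntegral_const]
    refine (setLIntegral_mono' (Metric.isOpen_ball.measurableSet.prod measurableSet_Ioi)
      fun z hz => ?_).trans (lintegral_mono_set (prod_mono le_rfl (subset_univ _)))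
    rw [min_eq_right (le_of_lt hz.2)]
  by_contra! hcon
  rw [top_le_iff.1 hcon, ENNReal.mul_top hn, ENNReal.mul_top (ENNReal.ofReal_pos.2 hx).ne'] at h2
  exact absurd (h2.trans_lt h1) (lt_irrefl _)

end Intensity

theorem withDensity_singleton_eq_zero (f : ℝ → ℝ≥0∞) (x : ℝ) : (volume.withDensity f) {x} = 0 :=
  withDensity_absolutelyContinuous _ _ Real.volume_singleton

/-- If the total mass of a completely random measure has a density, then the intensity measure is
infinite. -/
theorem IsPoissonProcess.measure_univ_eq_top {Ω X : Type*} [MeasurableSpace Ω] [MeasurableSpace X]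
    {P : Measure Ω} [IsProbabilityMeasure P] {η : Measure X} [IsProbabilityMeasure η]
    {ρ : Measure ℝ} [SigmaFinite ρ] {N : Ω → Measure (X × ℝ)}
    (hN : IsPoissonProcess N (η.prod ρ) P)
    {f : ℝ → ℝ≥0∞} (hT : P.map (fun ω => mass (crm (N ω))) = volume.withDensity f) :
    ρ univ = ∞ := by
  by_contra hcon
  have huniv : (η.prod ρ) univ = ρ univ := by
    rw [← univ_prod_univ, Measure.prod_prod, measure_univ, one_mul]
  -- At the parameter `∞` this says that a finite intensity leaves the process empty with positive
  -- probability. The mass would then have an atom at `0`.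
  have h1 := hN.lintegral_expNeg_mul_apply MeasurableSet.univ (by rwa [huniv]) ∞
  have hm : Measurable fun ω => mass (crm (N ω)) :=
    ((Measure.measurable_coe MeasurableSet.univ).comp
      (measurable_crm.comp hN.measurable)).ennreal_toReal
  have h2 : P {ω | mass (crm (N ω)) = 0} = 0 := by
    have := withDensity_singleton_eq_zero f 0
    rwa [← hT, Measure.map_apply hm (measurableSet_singleton 0)] at this
  have h3 : ∀ᵐ ω ∂P, expNeg (∞ * N ω univ) = 0 := by
    have : ∀ᵐ ω ∂P, mass (crm (N ω)) ≠ 0 := by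
      rw [ae_iff]; simpa using h2
    filter_upwards [this] with ω hω
    have hne : N ω univ ≠ 0 := fun h0 => hω (by
      rw [Measure.measure_univ_eq_zero] at h0
      rw [mass, crm_apply _ MeasurableSet.univ, h0]
      simp)
    rw [ENNReal.top_mul hne, expNeg_top]
  rw [lintegral_congr_ae h3, lintegral_zero, expNeg_top, tsub_zero, one_mul, huniv] at h1
  exact expNeg_pos hcon h1.symm

/-! ### Partitions generated by ties. -/

theorem tiePartition_comp_of_injective {α β : Type*} {n : ℕ} {z : α → β}
    (hz : Function.Injective z) (I : Fin n → α) :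
    tiePartition (fun i => z (I i)) = tiePartition I := by
  have : Setoid.ker (fun i => z (I i)) = Setoid.ker I := by
    ext i j
    simp [Setoid.ker_def, hz.eq_iff]
  unfold tiePartition
  rw [this]

/-- A partition is determined by its equivalence relation. The pairwise form makes the event a
finite intersection, hence measurable. -/
theorem tiePartition_eq_iff {α : Type*} {n : ℕ} (y : Fin n → α)
    (p : Finpartition (Finset.univ : Finset (Fin n))) :
    tiePartition y = p ↔ ∀ i j, y i = y j ↔ p.part i = p.part j := by
  have hpart : ∀ (q : Finpartition (Finset.univ : Finset (Fin n))) i j,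
      j ∈ q.part i ↔ q.part i = q.part j := fun q i j => by
    rw [eq_comm]
    exact q.mem_part_iff_part_eq_part (Finset.mem_univ _) (Finset.mem_univ _)
  constructor
  · rintro rfl i j
    rw [← mem_part_tiePartition, hpart]
  · intro h
    have hp : ∀ i, (tiePartition y).part i = p.part i := fun i => by
      ext j
      rw [mem_part_tiePartition, hpart, h]
    have key : ∀ q r : Finpartition (Finset.univ : Finset (Fin n)),
        (∀ i, q.part i = r.part i) → q.parts ⊆ r.parts := fun q r hqr t ht => by
      obtain ⟨i, hi⟩ := q.nonempty_of_mem_parts ht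
      rw [← q.part_eq_of_mem ht hi, hqr]
      exact r.part_mem.2 (Finset.mem_univ i)
    ext1
    exact (key _ _ hp).antisymm (key _ _ fun i => (hp i).symm)

theorem measurableSet_tiePartition_eq {X : Type*} [MeasurableSpace X] [MeasurableEq X]
    {n : ℕ} (p : Finpartition (Finset.univ : Finset (Fin n))) :
    MeasurableSet {y : Fin n → X | tiePartition y = p} := by
  have e : {y : Fin n → X | tiePartition y = p} =
      ⋂ i, ⋂ j, {y : Fin n → X | y i = y j ↔ p.part i = p.part j} := by
    ext y
    simp [tiePartition_eq_iff]
  rw [e]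
  refine MeasurableSet.iInter fun i => MeasurableSet.iInter fun j => ?_
  have h : MeasurableSet {y : Fin n → X | y i = y j} :=
    measurableSet_eq_fun (measurable_pi_apply i) (measurable_pi_apply j)
  exact h.iff (MeasurableSet.const _)

/-- The probability that a sample from the masses `w` generates the partition `p`. -/
noncomputable def massPartition {n : ℕ} (w : ℕ → ℝ)
    (p : Finpartition (Finset.univ : Finset (Fin n))) : ℝ≥0∞ :=
  ∑' I : Fin n → ℕ, {I : Fin n → ℕ | tiePartition I = p}.indicator
    (fun I => ∏ i, ENNReal.ofReal (w (I i))) I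

theorem pi_sum_dirac_eq_massPartition {n : ℕ} (w : ℕ → ℝ)
    (p : Finpartition (Finset.univ : Finset (Fin n))) :
    (Measure.pi fun _ : Fin n => Measure.sum fun k : ℕ => ENNReal.ofReal (w k) • Measure.dirac k)
      {I : Fin n → ℕ | tiePartition I = p} = massPartition w p := by
  set m := Measure.sum fun k : ℕ => ENNReal.ofReal (w k) • (Measure.dirac k : Measure ℕ) with hm
  have hsingle : ∀ k, m {k} = ENNReal.ofReal (w k) := fun k => Measure.sum_smul_dirac_singleton
  -- The masses need not be summable. Finiteness on singletons gives the σ-finiteness behind the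
  -- formula for product measures.
  have : IsLocallyFiniteMeasure m := ⟨fun k => ⟨{k}, mem_nhds_discrete.2 rfl, by
    rw [hsingle]; exact ENNReal.ofReal_lt_top⟩⟩
  rw [massPartition, ← lintegral_indicator_one (Set.to_countable _).measurableSet,
    lintegral_countable']
  refine tsum_congr fun I => ?_
  rw [← univ_pi_singleton, Measure.pi_pi]
  simp_rw [hsingle]
  by_cases hI : tiePartition I = p
  · rw [indicator_of_mem (by exact hI), indicator_of_mem (by exact hI), Pi.one_apply, one_mul]
  · rw [indicator_of_notMem (by exact hI), indicator_of_notMem (by exact hI), zero_mul]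

theorem massPartitionProb_eq {n : ℕ} (Q : Measure (ℕ → ℝ))
    (p : Finpartition (Finset.univ : Finset (Fin n))) :
    massPartitionProb Q p = ∫⁻ w, massPartition w p ∂Q :=
  lintegral_congr fun w => pi_sum_dirac_eq_massPartition w p

theorem measurable_massPartition {n : ℕ} (p : Finpartition (Finset.univ : Finset (Fin n))) :
    Measurable fun w => massPartition w p := by
  refine Measurable.tsum fun I => ?_
  by_cases hI : tiePartition I = p
  · simp only [indicator_of_mem (show I ∈ {I : Fin n → ℕ | tiePartition I = p} from hI)]
    fun_prop
  · simp only [indicator_of_notMem (show I ∉ {I : Fin n → ℕ | tiePartition I = p} from hI)]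
    exact measurable_const

theorem massPartition_le {n : ℕ} (w : ℕ → ℝ)
    (p : Finpartition (Finset.univ : Finset (Fin n))) :
    massPartition w p ≤ (∑' k, ENNReal.ofReal (w k)) ^ n := by
  have h := ENNReal.prod_tsum fun (_ : Fin n) k => ENNReal.ofReal (w k)
  rw [Finset.prod_const, Finset.card_univ, Fintype.card_fin] at h
  rw [h]
  exact ENNReal.tsum_le_tsum fun I => indicator_le_self _ _ I

/-- Index families that generate `p` are constant on its cells and take different values on
different cells. They are the compositions of injective maps on the cells with the map from a point
to its cell. -/
theorem massPartition_eq_distinctSum {n : ℕ} (w : ℕ → ℝ)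
    (p : Finpartition (Finset.univ : Finset (Fin n))) :
    massPartition w p = distinctSum fun (c : p.parts) k =>
      ENNReal.ofReal (w k) ^ (c : Finset (Fin n)).card := by
  let cell : Fin n → p.parts := fun i => ⟨p.part i, p.part_mem.2 (Finset.mem_univ i)⟩
  have hcell : ∀ (c : p.parts) i, cell i = c ↔ i ∈ (c : Finset (Fin n)) := fun c i => by
    rw [Subtype.ext_iff]
    exact ⟨fun h => h ▸ p.mem_part (Finset.mem_univ i), fun h => p.part_eq_of_mem c.2 h⟩
  have hsurj : Function.Surjective cell := fun c => by
    obtain ⟨i, hi⟩ := p.nonempty_of_mem_parts c.2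
    exact ⟨i, (hcell c i).2 hi⟩
  have hcc : ∀ i j, p.part i = p.part j ↔ cell i = cell j := fun i j => by
    rw [Subtype.ext_iff]
  have hinj : Function.Injective fun e : p.parts → ℕ => fun i => e (cell i) := fun e e' h => by
    ext c
    obtain ⟨i, rfl⟩ := hsurj c
    exact congrFun h i
  have htie : ∀ e : p.parts → ℕ, tiePartition (fun i => e (cell i)) = p ↔ Function.Injective e := by
    intro e
    rw [tiePartition_eq_iff]
    refine ⟨fun h c d hcd => ?_, fun h i j => by rw [hcc, h.eq_iff]⟩
    obtain ⟨i, rfl⟩ := hsurj c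
    obtain ⟨j, rfl⟩ := hsurj d
    rwa [h, hcc] at hcd
  rw [massPartition, distinctSum, ← hinj.tsum_eq]
  · refine tsum_congr fun e => ?_
    by_cases he : Function.Injective e
    · rw [indicator_of_mem (by exact (htie e).2 he), indicator_of_mem (by exact he)]
      rw [← Finset.prod_fiberwise_of_maps_to (s := Finset.univ) (t := Finset.univ) (g := cell)
        fun i _ => Finset.mem_univ _]
      refine Finset.prod_congr rfl fun c _ => ?_
      rw [Finset.prod_congr rfl (g := fun _ => ENNReal.ofReal (w (e c))) fun i hi => by
        dsimp only
        rw [(Finset.mem_filter.1 hi).2], Finset.prod_const]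
      congr 2
      ext i
      simp [hcell]
    · rw [indicator_of_notMem (by exact fun h => he ((htie e).1 h)),
        indicator_of_notMem (by exact he)]
  · intro I hI
    have hI' : tiePartition I = p := by
      by_contra hcon
      exact hI (indicator_of_notMem (by exact hcon) _)
    rw [tiePartition_eq_iff] at hI'
    choose r hr using hsurj
    refine ⟨fun c => I (r c), funext fun i => ?_⟩
    exact (hI' _ _).2 ((hcc _ _).2 (hr _))

/-- Almost surely there are no ties in a sample from a diffuse distribution. -/
theorem ae_injective_infinitePi {X : Type*} [MeasurableSpace X] [MeasurableEq X]
    (η : Measure X) [IsProbabilityMeasure η] (hη : ∀ x, η {x} = 0) :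
    ∀ᵐ z ∂(Measure.infinitePi fun _ : ℕ => η), Function.Injective z := by
  have h : ∀ i j : ℕ, ∀ᵐ z ∂(Measure.infinitePi fun _ : ℕ => η), z i = z j → i = j := by
    intro i j
    by_cases hij : i = j
    · exact .of_forall fun _ _ => hij
    have hm : Measurable fun z : ℕ → X => (z i, z j) := by fun_prop
    have h1 : (η.prod η) (diagonal X) = 0 := by
      rw [Measure.measure_prod_null measurableSet_diagonal]
      refine .of_forall fun x => ?_
      have : Prod.mk x ⁻¹' diagonal X = {x} := by ext y; simp [eq_comm]
      exact (congrArg η this).trans (hη x)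
    rw [← Measure.infinitePi_map_eval_prod (P := fun _ : ℕ => η) hij,
      Measure.map_apply hm measurableSet_diagonal] at h1
    rw [ae_iff]
    refine measure_mono_null (fun z hz => ?_) h1
    by_contra hcon
    exact hz fun hh => absurd hh hcon
  filter_upwards [ae_all_iff.2 fun i => ae_all_iff.2 (h i)] with z hz i j using hz i j

/-! ### Disintegration by the sum of the points, and the tilt. -/

theorem measurable_pointSum : Measurable pointSum :=
  (Measure.measurable_lintegral ENNReal.measurable_ofReal).ennreal_toReal

theorem measurable_mass {X : Type*} [MeasurableSpace X] :
    Measurable (mass : Measure X → ℝ) :=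
  (Measure.measurable_coe MeasurableSet.univ).ennreal_toReal

theorem measurable_normalized {X : Type*} [MeasurableSpace X] :
    Measurable (normalized : Measure X → Measure X) := by
  refine Measure.measurable_of_measurable_coe _ fun A hA => ?_
  simp only [normalized, Measure.smul_apply, smul_eq_mul]
  exact (Measure.measurable_coe MeasurableSet.univ).inv.mul (Measure.measurable_coe hA)

theorem normalized_atomicMeasure {X : Type*} [MeasurableSpace X] {w : ℕ → ℝ} {T : ℝ}
    (hT : 0 < T) (hw : ∑' k, ENNReal.ofReal (w k) = ENNReal.ofReal T) (z : ℕ → X) :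
    normalized (atomicMeasure w z) = atomicMeasure (fun k => w k / T) z := by
  ext A hA
  rw [normalized, atomicMeasure_univ, hw, Measure.smul_apply, atomicMeasure_apply _ _ hA,
    atomicMeasure_apply _ _ hA, smul_eq_mul, ← ENNReal.tsum_mul_left]
  refine tsum_congr fun k => ?_
  rw [ENNReal.ofReal_div_of_pos hT, div_eq_mul_inv]
  ring

/-- The sequence of the ranked points divided by their sum. -/
noncomputable def normalizedPoints (m : Measure ℝ) (k : ℕ) : ℝ := rankedPoint m k / pointSum m

theorem measurable_normalizedPoints : Measurable normalizedPoints :=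
  measurable_pi_lambda _ fun k => (measurable_rankedPoint k).div measurable_pointSum

instance {Ω : Type*} [MeasurableSpace Ω] (M : Ω → Measure ℝ) (P : Measure Ω) [IsFiniteMeasure P] :
    IsMarkovKernel (pkKernel M P) := by
  unfold pkKernel; infer_instance

theorem IsPointConfiguration.pointSum_eq {m : Measure ℝ} (hm : IsPointConfiguration m) :
    pointSum m = (rankedSum m).toReal := by
  rw [pointSum, rankedSum, hm.lintegral_eq_tsum ENNReal.measurable_ofReal]

/-- An infinite sum is recorded as `0` by `toReal`. Since a density gives no mass to `{0}`, both
vanishing and infinite sums are excluded at once. -/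
theorem ae_pointSum_pos {Ω₀ : Type*} [MeasurableSpace Ω₀] {P₀ : Measure Ω₀}
    {M : Ω₀ → Measure ℝ} {f : ℝ → ℝ≥0∞} (hM : Measurable M) (hcfg : ∀ᵐ ω ∂P₀, IsPointConfiguration (M ω))
    (hT : P₀.map (fun ω => pointSum (M ω)) = volume.withDensity f) :
    ∀ᵐ ω ∂P₀, 0 < pointSum (M ω) ∧ rankedSum (M ω) = ENNReal.ofReal (pointSum (M ω)) := by
  have hS : Measurable fun ω => pointSum (M ω) := measurable_pointSum.comp hM
  have h1 : ∀ᵐ ω ∂P₀, pointSum (M ω) ≠ 0 := by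
    have := withDensity_singleton_eq_zero f 0
    rw [← hT, Measure.map_apply hS (measurableSet_singleton 0)] at this
    rw [ae_iff]
    refine measure_mono_null (fun ω hω => ?_) this
    simpa using hω
  filter_upwards [h1, hcfg] with ω h0 hω
  refine ⟨lt_of_le_of_ne ENNReal.toReal_nonneg h0.symm, ?_⟩
  rw [hω.pointSum_eq, ENNReal.ofReal_toReal]
  intro htop
  rw [hω.pointSum_eq, htop] at h0
  exact h0 rfl

theorem density_eq_zero_of_nonpos {Ω₀ : Type*} [MeasurableSpace Ω₀] {P₀ : Measure Ω₀}
    {M : Ω₀ → Measure ℝ} {f : ℝ → ℝ≥0∞} (hM : Measurable M)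
    (hcfg : ∀ᵐ ω ∂P₀, IsPointConfiguration (M ω)) (hf : Measurable f)
    (hT : P₀.map (fun ω => pointSum (M ω)) = volume.withDensity f) :
    ∀ᵐ t, t ≤ 0 → f t = 0 := by
  have hS : Measurable fun ω => pointSum (M ω) := measurable_pointSum.comp hM
  have h1 : (volume.withDensity f) (Iic 0) = 0 := by
    rw [← hT, Measure.map_apply hS measurableSet_Iic]
    have : ∀ᵐ ω ∂P₀, ¬ pointSum (M ω) ≤ 0 := by
      filter_upwards [ae_pointSum_pos hM hcfg hT] with ω hω using not_le.2 hω.1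
    rw [ae_iff] at this
    simp only [not_not] at this
    exact this
  rw [withDensity_apply _ measurableSet_Iic, setLIntegral_eq_zero_iff measurableSet_Iic hf] at h1
  exact h1

section Model

variable {X Ω Ω₀ : Type*} [MeasurableSpace X] [MeasurableSpace Ω] [MeasurableSpace Ω₀]
  {P : Measure Ω} [IsProbabilityMeasure P] {P₀ : Measure Ω₀} [IsProbabilityMeasure P₀]
  {η : Measure X} [IsProbabilityMeasure η] {ρ : Measure ℝ} [SigmaFinite ρ]
  {N : Ω → Measure (X × ℝ)} {M : Ω₀ → Measure ℝ} {f : ℝ → ℝ≥0∞} {h : ℝ → ℝ}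

theorem IsPoissonProcess.map_pointSum (hN : IsPoissonProcess N (η.prod ρ) P)
    (hM : IsPoissonProcess M ρ P₀) (hcfg : ∀ᵐ ω ∂P₀, IsPointConfiguration (M ω)) :
    P₀.map (fun ω => pointSum (M ω)) = P.map (fun ω => mass (crm (N ω))) := by
  have hm1 : Measurable fun ω => crm (N ω) := measurable_crm.comp hN.measurable
  have hm2 := measurable_atomicMeasure (X := X) (α := Ω₀ × (ℕ → X))
    (w := fun p => rankedPoint (M p.1))
    (measurable_rankedPoint_seq.comp (hM.measurable.comp measurable_fst)) measurable_snd
  have h1 := congrArg (Measure.map mass) (hN.map_crm hM hcfg)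
  rw [Measure.map_map measurable_mass hm1, Measure.map_map measurable_mass hm2] at h1
  have h2 : (mass ∘ fun p : Ω₀ × (ℕ → X) => atomicMeasure (rankedPoint (M p.1)) p.2) =
      (fun ω => (rankedSum (M ω)).toReal) ∘ Prod.fst := by
    ext p
    simp only [Function.comp_apply, mass, atomicMeasure_univ, rankedSum]
  have hR : Measurable fun ω => (rankedSum (M ω)).toReal :=
    (measurable_rankedSum.comp hM.measurable).ennreal_toReal
  rw [h2, ← Measure.map_map hR measurable_fst, Measure.map_fst_prod, measure_univ, one_smul] at h1
  refine Eq.trans (Measure.map_congr ?_) h1.symm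
  filter_upwards [hcfg] with ω hω using hω.pointSum_eq

/-- The weight depends on the points only through their sum, so it leaves the integral over the
marks. -/
theorem lintegral_tiltedLaw (hN : IsPoissonProcess N (η.prod ρ) P)
    (hM : IsPoissonProcess M ρ P₀) (hcfg : ∀ᵐ ω ∂P₀, IsPointConfiguration (M ω))
    (hT : P₀.map (fun ω => pointSum (M ω)) = volume.withDensity f) (hh : Measurable h)
    {F : Measure X → ℝ≥0∞} (hF : Measurable F) :
    ∫⁻ m, F m ∂(tiltedLaw h (P.map fun ω => crm (N ω))) =
      (∫⁻ m, ENNReal.ofReal (h (mass m)) ∂(P.map fun ω => crm (N ω)))⁻¹ *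
        ∫⁻ ω, ENNReal.ofReal (h (pointSum (M ω))) *
          ∫⁻ z, F (atomicMeasure (rankedPoint (M ω)) z) ∂(Measure.infinitePi fun _ : ℕ => η)
          ∂P₀ := by
  have hH : Measurable fun m : Measure X => ENNReal.ofReal (h (mass m)) :=
    (hh.comp measurable_mass).ennreal_ofReal
  have hm2 := measurable_atomicMeasure (X := X) (α := Ω₀ × (ℕ → X))
    (w := fun p => rankedPoint (M p.1))
    (measurable_rankedPoint_seq.comp (hM.measurable.comp measurable_fst)) measurable_snd
  rw [tiltedLaw, lintegral_smul_measure, smul_eq_mul,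
    lintegral_withDensity_eq_lintegral_mul _ hH hF]
  congr 1
  rw [hN.map_crm hM hcfg, lintegral_map (hH.mul hF) hm2]
  refine (lintegral_prod _ ((hH.mul hF).comp hm2).aemeasurable).trans ?_
  refine lintegral_congr_ae ?_
  filter_upwards [ae_pointSum_pos hM.measurable hcfg hT] with ω hω
  have h1 : ∀ z : ℕ → X, mass (atomicMeasure (rankedPoint (M ω)) z) = pointSum (M ω) := fun z => by
    rw [mass, atomicMeasure_univ]
    change (rankedSum (M ω)).toReal = _
    rw [hω.2, ENNReal.toReal_ofReal hω.1.le]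
  simp_rw [Function.comp_apply, Pi.mul_apply, h1]
  exact lintegral_const_mul _ (hF.comp (measurable_atomicMeasure measurable_const measurable_id))

theorem lintegral_pointSum_normalizedPoints (hM : Measurable M) (hf : Measurable f)
    (hT : P₀.map (fun ω => pointSum (M ω)) = volume.withDensity f)
    {Φ : ℝ × (ℕ → ℝ) → ℝ≥0∞} (hΦ : Measurable Φ) :
    ∫⁻ ω, Φ (pointSum (M ω), normalizedPoints (M ω)) ∂P₀ =
      ∫⁻ t, f t * ∫⁻ w, Φ (t, w) ∂(pkKernel M P₀ t) := by
  have hS : Measurable fun ω => pointSum (M ω) := measurable_pointSum.comp hM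
  have hW : Measurable fun ω => normalizedPoints (M ω) := measurable_normalizedPoints.comp hM
  have h1 : (P₀.map fun ω => pointSum (M ω)) ⊗ₘ pkKernel M P₀ =
      P₀.map fun ω => (pointSum (M ω), normalizedPoints (M ω)) :=
    compProd_map_condDistrib hW.aemeasurable
  have h2 : Measurable fun t => ∫⁻ w, Φ (t, w) ∂(pkKernel M P₀ t) := by
    exact hΦ.lintegral_kernel_prod_right'
  rw [← lintegral_map hΦ (hS.prodMk hW), ← h1, Measure.lintegral_compProd hΦ, hT,
    lintegral_withDensity_eq_lintegral_mul _ hf h2]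
  rfl

theorem lintegral_tilt_eq (hN : IsPoissonProcess N (η.prod ρ) P) (hM : IsPoissonProcess M ρ P₀)
    (hcfg : ∀ᵐ ω ∂P₀, IsPointConfiguration (M ω)) (hf : Measurable f)
    (hT : P₀.map (fun ω => pointSum (M ω)) = volume.withDensity f) (hh : Measurable h) :
    ∫⁻ m, ENNReal.ofReal (h (mass m)) ∂(P.map fun ω => crm (N ω)) =
      ∫⁻ t in Ioi (0 : ℝ), ENNReal.ofReal (h t) * f t := by
  have hm1 : Measurable fun ω => crm (N ω) := measurable_crm.comp hN.measurable
  have hH : Measurable fun t => ENNReal.ofReal (h t) := hh.ennreal_ofReal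
  have hmc : Measurable fun ω => mass (crm (N ω)) := measurable_mass.comp hm1
  have hHm : Measurable fun m : Measure X => ENNReal.ofReal (h (mass m)) :=
    hH.comp measurable_mass
  rw [lintegral_map hHm hm1]
  have h1 : ∫⁻ ω, ENNReal.ofReal (h (mass (crm (N ω)))) ∂P =
      ∫⁻ t, ENNReal.ofReal (h t) ∂(P.map fun ω => mass (crm (N ω))) :=
    (lintegral_map hH hmc).symm
  rw [h1, ← hN.map_pointSum hM hcfg, hT, lintegral_withDensity_eq_lintegral_mul _ hf hH,
    ← lintegral_indicator measurableSet_Ioi]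
  refine lintegral_congr_ae ?_
  filter_upwards [density_eq_zero_of_nonpos hM.measurable hcfg hf hT] with t ht
  rw [Pi.mul_apply, mul_comm]
  by_cases h0 : 0 < t
  · rw [indicator_of_mem (by exact h0)]
  · rw [indicator_of_notMem (by exact h0), ht (not_lt.1 h0), mul_zero]

theorem measurable_tiltedDensity (hh : Measurable h) (hf : Measurable f) :
    Measurable (tiltedDensity h f) :=
  (hh.ennreal_ofReal.mul hf).div_const _

/-- Integration of a function of the sum and of the normalized points against the tilt. -/
theorem lintegral_tilt_mul (hN : IsPoissonProcess N (η.prod ρ) P) (hM : IsPoissonProcess M ρ P₀)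
    (hcfg : ∀ᵐ ω ∂P₀, IsPointConfiguration (M ω)) (hf : Measurable f)
    (hT : P₀.map (fun ω => pointSum (M ω)) = volume.withDensity f) (hh : Measurable h)
    {Φ : ℝ × (ℕ → ℝ) → ℝ≥0∞} (hΦ : Measurable Φ) :
    (∫⁻ m, ENNReal.ofReal (h (mass m)) ∂(P.map fun ω => crm (N ω)))⁻¹ *
        ∫⁻ ω, ENNReal.ofReal (h (pointSum (M ω))) *
          Φ (pointSum (M ω), normalizedPoints (M ω)) ∂P₀ =
      ∫⁻ t, ∫⁻ w, Φ (t, w) ∂(pkKernel M P₀ t) ∂(volume.withDensity (tiltedDensity h f)) := by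
  have h2 : Measurable fun t => ∫⁻ w, Φ (t, w) ∂(pkKernel M P₀ t) :=
    hΦ.lintegral_kernel_prod_right'
  have h3 := lintegral_pointSum_normalizedPoints hM.measurable hf hT
    (Φ := fun q => ENNReal.ofReal (h q.1) * Φ q) ((hh.comp measurable_fst).ennreal_ofReal.mul hΦ)
  have h4 : ∀ t, ∫⁻ w, ENNReal.ofReal (h t) * Φ (t, w) ∂(pkKernel M P₀ t) =
      ENNReal.ofReal (h t) * ∫⁻ w, Φ (t, w) ∂(pkKernel M P₀ t) := fun t =>
    lintegral_const_mul _ (hΦ.comp measurable_prodMk_left)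
  simp_rw [h4] at h3
  rw [h3, lintegral_tilt_eq hN hM hcfg hf hT hh,
    lintegral_withDensity_eq_lintegral_mul _ (measurable_tiltedDensity hh hf) h2,
    ← lintegral_const_mul _ (show Measurable fun t => f t * (ENNReal.ofReal (h t) *
      ∫⁻ w, Φ (t, w) ∂(pkKernel M P₀ t)) from hf.mul (hh.ennreal_ofReal.mul h2))]
  refine lintegral_congr fun t => ?_
  rw [Pi.mul_apply, tiltedDensity, ENNReal.div_eq_inv_mul]
  ring

/-- The law of the normalization of the tilted completely random measure. -/
theorem map_normalized_tiltedLaw (hN : IsPoissonProcess N (η.prod ρ) P)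
    (hM : IsPoissonProcess M ρ P₀)
    (hcfg : ∀ᵐ ω ∂P₀, IsPointConfiguration (M ω)) (hf : Measurable f)
    (hT : P₀.map (fun ω => pointSum (M ω)) = volume.withDensity f) (hh : Measurable h) :
    (tiltedLaw h (P.map fun ω => crm (N ω))).map normalized =
      speciesLaw ((volume.withDensity (tiltedDensity h f)).bind (pkKernel M P₀)) η := by
  ext S hS
  have hat := measurable_atomicMeasure (X := X) (α := (ℕ → ℝ) × (ℕ → X)) (w := fun p => p.1)
    measurable_fst measurable_snd
  have hI : Measurable (S.indicator (1 : Measure X → ℝ≥0∞)) := measurable_one.indicator hS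
  rw [← lintegral_indicator_one hS, lintegral_map hI measurable_normalized]
  refine (lintegral_tiltedLaw hN hM hcfg hT hh (hI.comp measurable_normalized)).trans ?_
  have hΨ : Measurable fun w : ℕ → ℝ => ∫⁻ z, S.indicator (1 : Measure X → ℝ≥0∞)
      (atomicMeasure w z) ∂(Measure.infinitePi fun _ : ℕ => η) :=
    Measurable.lintegral_prod_right' (f := fun p : (ℕ → ℝ) × (ℕ → X) =>
      S.indicator (1 : Measure X → ℝ≥0∞) (atomicMeasure p.1 p.2)) (hI.comp hat)
  have h1 := lintegral_tilt_mul hN hM hcfg hf hT hh (hΨ.comp measurable_snd)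
  have h2 : speciesLaw ((volume.withDensity (tiltedDensity h f)).bind (pkKernel M P₀)) η S =
      ∫⁻ t, ∫⁻ w, ∫⁻ z, S.indicator (1 : Measure X → ℝ≥0∞)
        (atomicMeasure w z) ∂(Measure.infinitePi fun _ : ℕ => η) ∂(pkKernel M P₀ t)
        ∂(volume.withDensity (tiltedDensity h f)) := by
    rw [← Measure.lintegral_bind (pkKernel M P₀).measurable.aemeasurable hΨ.aemeasurable,
      ← lintegral_indicator_one hS]
    refine (lintegral_map hI hat).trans ?_
    exact lintegral_prod _ (hI.comp hat).aemeasurable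
  rw [h2]
  refine Eq.trans ?_ h1
  congr 1
  refine lintegral_congr_ae ?_
  filter_upwards [ae_pointSum_pos hM.measurable hcfg hT] with ω hω
  -- Normalizing divides the weights by their sum and leaves the marks in place.
  simp_rw [Function.comp_apply, normalized_atomicMeasure hω.1 hω.2]
  rfl

end Model

/-! ### The sample and the partition that it generates. -/

theorem atomicMeasure_div_univ {X : Type*} [MeasurableSpace X] {w : ℕ → ℝ} {T : ℝ}
    (hT : 0 < T) (hw : ∑' k, ENNReal.ofReal (w k) = ENNReal.ofReal T) (z : ℕ → X) {A : Set X}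
    (hA : MeasurableSet A) :
    atomicMeasure w z A / atomicMeasure w z univ =
      ∑' k, ENNReal.ofReal (w k / T) * A.indicator 1 (z k) := by
  rw [← atomicMeasure_apply _ _ hA, ← normalized_atomicMeasure hT hw, normalized,
    Measure.smul_apply, smul_eq_mul, ENNReal.div_eq_inv_mul]

section Sample

variable {X Ω Ω₀ Ω' : Type*} [MeasurableSpace X] [MeasurableSpace Ω]
  [MeasurableSpace Ω₀] [MeasurableSpace Ω']
  {P : Measure Ω} [IsProbabilityMeasure P] {P₀ : Measure Ω₀} [IsProbabilityMeasure P₀]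
  {P' : Measure Ω'} [IsProbabilityMeasure P']
  {η : Measure X} [IsProbabilityMeasure η] {ρ : Measure ℝ} [SigmaFinite ρ]
  {N : Ω → Measure (X × ℝ)} {M : Ω₀ → Measure ℝ} {f : ℝ → ℝ≥0∞} {h : ℝ → ℝ}
  {n : ℕ} {μ : Ω' → Measure X} {Y : Fin n → Ω' → X}

/-- The joint law of the tilted total mass and the sample, in terms of the ranked points and
independent atoms. -/
theorem map_sample_restrict_mass (hN : IsPoissonProcess N (η.prod ρ) P)
    (hM : IsPoissonProcess M ρ P₀) (hcfg : ∀ᵐ ω ∂P₀, IsPointConfiguration (M ω))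
    (hT : P₀.map (fun ω => pointSum (M ω)) = volume.withDensity f) (hh : Measurable h)
    (hY : IsNormalizedSample (tiltedLaw h (P.map fun ω => crm (N ω))) μ Y P')
    {D : Set ℝ} (hD : MeasurableSet D) {S : Set (Fin n → X)} (hS : MeasurableSet S) :
    P' {ω | mass (μ ω) ∈ D ∧ (fun i => Y i ω) ∈ S} =
      (∫⁻ m, ENNReal.ofReal (h (mass m)) ∂(P.map fun ω => crm (N ω)))⁻¹ *
        ∫⁻ ω, ENNReal.ofReal (h (pointSum (M ω))) * (D.indicator 1 (pointSum (M ω)) *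
          ∑' I : Fin n → ℕ, (∏ i, ENNReal.ofReal (normalizedPoints (M ω) (I i))) *
            ∫⁻ z, S.indicator 1 (fun i => z (I i)) ∂(Measure.infinitePi fun _ : ℕ => η)) ∂P₀ := by
  set c := ∫⁻ m, ENNReal.ofReal (h (mass m)) ∂(P.map fun ω => crm (N ω))
  have hSm : Measurable fun ω => pointSum (M ω) := measurable_pointSum.comp hM.measurable
  have hWm : ∀ k, Measurable fun ω => normalizedPoints (M ω) k := fun k =>
    (measurable_pi_iff.1 (measurable_normalizedPoints.comp hM.measurable) k)
  have hYm : Measurable fun ω i => Y i ω := measurable_pi_lambda _ hY.measurable_sample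
  have hmm : Measurable fun ω => mass (μ ω) := measurable_mass.comp hY.measurable_measure
  have hDi : Measurable fun ω => D.indicator (1 : ℝ → ℝ≥0∞) (pointSum (M ω)) :=
    (measurable_one.indicator hD).comp hSm
  let v : (Fin n → ℕ) → Ω₀ → ℝ≥0∞ := fun I ω => ENNReal.ofReal (h (pointSum (M ω))) *
    (D.indicator 1 (pointSum (M ω)) * ∏ i, ENNReal.ofReal (normalizedPoints (M ω) (I i)))
  have hv : ∀ I, Measurable (v I) := fun I =>
    (hh.comp hSm).ennreal_ofReal.mul (hDi.mul (Finset.measurable_prod _ fun i _ =>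
      (hWm _).ennreal_ofReal))
  let ηn : (Fin n → ℕ) → Measure (Fin n → X) := fun I =>
    (Measure.infinitePi fun _ : ℕ => η).map fun z i => z (I i)
  have hzI : ∀ I : Fin n → ℕ, Measurable fun (z : ℕ → X) i => z (I i) := fun I => by fun_prop
  have hηn : ∀ I {S : Set (Fin n → X)}, MeasurableSet S → ηn I S =
      ∫⁻ z, S.indicator 1 (fun i => z (I i)) ∂(Measure.infinitePi fun _ : ℕ => η) :=
    fun I S hS => by
      rw [← lintegral_indicator_one hS]
      exact lintegral_map (measurable_one.indicator hS) (hzI I)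
  let m₁ : Measure (Fin n → X) :=
    (P'.restrict {ω | mass (μ ω) ∈ D}).map fun ω i => Y i ω
  -- A mixture over the drawn indices `I` of the laws of `(z (I i))`. The sampling hypothesis covers
  -- boxes only, while the tie event is not a box, so equality is proved as measures.
  let m₂ : Measure (Fin n → X) := c⁻¹ • Measure.sum fun I => (∫⁻ ω, v I ω ∂P₀) • ηn I
  have h₁ : ∀ S, MeasurableSet S → m₁ S = P' {ω | mass (μ ω) ∈ D ∧ (fun i => Y i ω) ∈ S} :=
    fun S hS => by
      rw [Measure.map_apply hYm hS, Measure.restrict_apply (hYm hS), inter_comm]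
      rfl
  have h₂ : ∀ S, MeasurableSet S → m₂ S = c⁻¹ * ∫⁻ ω, ENNReal.ofReal (h (pointSum (M ω))) *
      (D.indicator 1 (pointSum (M ω)) *
          ∑' I : Fin n → ℕ, (∏ i, ENNReal.ofReal (normalizedPoints (M ω) (I i))) *
            ∫⁻ z, S.indicator 1 (fun i => z (I i)) ∂(Measure.infinitePi fun _ : ℕ => η)) ∂P₀ :=
    fun S hS => by
      rw [Measure.smul_apply, smul_eq_mul, Measure.sum_apply _ hS]
      simp_rw [Measure.smul_apply, smul_eq_mul, ← lintegral_mul_const _ (hv _)]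
      rw [← lintegral_tsum fun I => ((hv I).mul_const _).aemeasurable]
      congr 1
      refine lintegral_congr fun ω => ?_
      rw [← ENNReal.tsum_mul_left, ← ENNReal.tsum_mul_left]
      refine tsum_congr fun I => ?_
      rw [hηn I hS]
      simp only [v]
      ring
  suffices m₁ = m₂ by rw [← h₁ S hS, this, h₂ S hS]
  have hbox : ∀ B : Fin n → Set X, (∀ i, MeasurableSet (B i)) →
      m₁ (univ.pi B) = m₂ (univ.pi B) := by
    intro B hB
    have hBm := MeasurableSet.univ_pi hB
    have hF : Measurable fun m : Measure X => D.indicator (1 : ℝ → ℝ≥0∞) (mass m) *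
        ∏ i, m (B i) / m univ :=
      ((measurable_one.indicator hD).comp measurable_mass).mul (Finset.measurable_prod _ fun i _ =>
        (Measure.measurable_coe (hB i)).div (Measure.measurable_coe MeasurableSet.univ))
    have h3 := hY.joint {m | mass m ∈ D} B (measurable_mass hD) hB
    have h4 : ∫⁻ m in {m | mass m ∈ D}, ∏ i, m (B i) / m univ
        ∂(tiltedLaw h (P.map fun ω => crm (N ω))) =
        ∫⁻ m, D.indicator (1 : ℝ → ℝ≥0∞) (mass m) * ∏ i, m (B i) / m univ
          ∂(tiltedLaw h (P.map fun ω => crm (N ω))) := by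
      have hDm : MeasurableSet {m : Measure X | mass m ∈ D} := measurable_mass hD
      rw [← lintegral_indicator hDm]
      refine lintegral_congr fun m => ?_
      by_cases hm : mass m ∈ D
      · rw [indicator_of_mem (by exact hm), indicator_of_mem hm, Pi.one_apply, one_mul]
      · rw [indicator_of_notMem (by exact hm), indicator_of_notMem hm, zero_mul]
    rw [h₁ _ hBm, h₂ _ hBm]
    have h5 : {ω | mass (μ ω) ∈ D ∧ (fun i => Y i ω) ∈ univ.pi B} =
        {ω | μ ω ∈ {m | mass m ∈ D} ∧ ∀ i, Y i ω ∈ B i} := by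
      ext ω; simp
    rw [h5, h3, h4, lintegral_tiltedLaw hN hM hcfg hT hh hF]
    congr 1
    refine lintegral_congr_ae ?_
    filter_upwards [ae_pointSum_pos hM.measurable hcfg hT] with ω hω
    have hind : ∀ (I : Fin n → ℕ) (z : ℕ → X),
        (univ.pi B).indicator (1 : (Fin n → X) → ℝ≥0∞) (fun i => z (I i)) =
          ∏ i, (B i).indicator 1 (z (I i)) := fun I z => by
      by_cases hz : ∀ i, z (I i) ∈ B i
      · rw [indicator_of_mem (by simpa using hz), Finset.prod_congr rfl fun i _ =>
          indicator_of_mem (hz i) _]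
        simp
      · rw [indicator_of_notMem (by simpa using hz)]
        push Not at hz
        obtain ⟨i, hi⟩ := hz
        rw [Finset.prod_eq_zero (Finset.mem_univ i) (indicator_of_notMem hi _)]
    have hindm : ∀ I : Fin n → ℕ, Measurable fun z : ℕ → X =>
        (univ.pi B).indicator (1 : (Fin n → X) → ℝ≥0∞) (fun i => z (I i)) := fun I =>
      (measurable_one.indicator hBm).comp (hzI I)
    have hmass : ∀ z : ℕ → X, mass (atomicMeasure (rankedPoint (M ω)) z) = pointSum (M ω) :=
      fun z => by
        rw [mass, atomicMeasure_univ]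
        change (rankedSum (M ω)).toReal = _
        rw [hω.2, ENNReal.toReal_ofReal hω.1.le]
    have hprod : ∀ z : ℕ → X, ∏ i, atomicMeasure (rankedPoint (M ω)) z (B i) /
        atomicMeasure (rankedPoint (M ω)) z univ =
        ∑' I : Fin n → ℕ, (∏ i, ENNReal.ofReal (normalizedPoints (M ω) (I i))) *
          (univ.pi B).indicator 1 (fun i => z (I i)) := fun z => by
      rw [Finset.prod_congr rfl fun i _ => atomicMeasure_div_univ hω.1 hω.2 z (hB i),
        ENNReal.prod_tsum]
      refine tsum_congr fun I => ?_
      rw [hind, ← Finset.prod_mul_distrib]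
      rfl
    congr 1
    simp_rw [hmass, hprod]
    rw [lintegral_const_mul _ (Measurable.tsum fun I => (hindm I).const_mul _),
      lintegral_tsum fun I => ((hindm I).const_mul _).aemeasurable]
    simp_rw [lintegral_const_mul _ (hindm _)]
  have : IsFiniteMeasure m₁ := by
    have : IsFiniteMeasure (P'.restrict {ω | mass (μ ω) ∈ D}) := inferInstance
    exact Measure.isFiniteMeasure_map _ _
  refine ext_of_generate_finite _ generateFrom_pi.symm isPiSystem_pi ?_ ?_
  · rintro _ ⟨B, hB, rfl⟩
    exact hbox B fun i => hB i (mem_univ i)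
  · have := hbox (fun _ => univ) fun _ => MeasurableSet.univ
    rwa [pi_univ] at this

/-- The joint law of the tilted total mass and the partition generated by the sample. -/
theorem measure_mass_tiePartition [MeasurableEq X] (hN : IsPoissonProcess N (η.prod ρ) P)
    (hM : IsPoissonProcess M ρ P₀) (hcfg : ∀ᵐ ω ∂P₀, IsPointConfiguration (M ω))
    (hf : Measurable f)
    (hT : P₀.map (fun ω => pointSum (M ω)) = volume.withDensity f) (hh : Measurable h)
    (hη : ∀ x, η {x} = 0)
    (hY : IsNormalizedSample (tiltedLaw h (P.map fun ω => crm (N ω))) μ Y P')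
    {D : Set ℝ} (hD : MeasurableSet D) (p : Finpartition (Finset.univ : Finset (Fin n))) :
    P' {ω | mass (μ ω) ∈ D ∧ (tiePartition fun i => Y i ω) = p} =
      ∫⁻ t in D, massPartitionProb (pkKernel M P₀ t) p
        ∂(volume.withDensity (tiltedDensity h f)) := by
  have h1 := map_sample_restrict_mass hN hM hcfg hT hh hY hD (measurableSet_tiePartition_eq p)
  -- The marks are almost surely distinct, so the sample has the same ties as the drawn indices and
  -- the integral over the marks is an indicator.
  have h2 : ∀ I : Fin n → ℕ, ∫⁻ z, {y : Fin n → X | tiePartition y = p}.indicator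
      (1 : (Fin n → X) → ℝ≥0∞) (fun i => z (I i)) ∂(Measure.infinitePi fun _ : ℕ => η) =
      {I : Fin n → ℕ | tiePartition I = p}.indicator 1 I := fun I => by
    have : ∀ᵐ z ∂(Measure.infinitePi fun _ : ℕ => η),
        {y : Fin n → X | tiePartition y = p}.indicator (1 : (Fin n → X) → ℝ≥0∞)
          (fun i => z (I i)) = {I : Fin n → ℕ | tiePartition I = p}.indicator 1 I := by
      filter_upwards [ae_injective_infinitePi η hη] with z hz
      simp only [indicator_apply, mem_ofPred_eq, tiePartition_comp_of_injective hz, Pi.one_apply]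
    rw [lintegral_congr_ae this, lintegral_const, measure_univ, mul_one]
  have h3 : ∀ ω, ∑' I : Fin n → ℕ, (∏ i, ENNReal.ofReal (normalizedPoints (M ω) (I i))) *
      {I : Fin n → ℕ | tiePartition I = p}.indicator (1 : (Fin n → ℕ) → ℝ≥0∞) I =
      massPartition (normalizedPoints (M ω)) p := fun ω => by
    refine tsum_congr fun I => ?_
    by_cases hI : tiePartition I = p
    · rw [indicator_of_mem (by exact hI), indicator_of_mem (by exact hI), Pi.one_apply, mul_one]
    · rw [indicator_of_notMem (by exact hI), indicator_of_notMem (by exact hI), mul_zero]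
  simp_rw [h2, h3] at h1
  refine h1.trans ?_
  have hΦ : Measurable fun q : ℝ × (ℕ → ℝ) =>
      D.indicator (1 : ℝ → ℝ≥0∞) q.1 * massPartition q.2 p :=
    ((measurable_one.indicator hD).comp measurable_fst).mul
      ((measurable_massPartition p).comp measurable_snd)
  refine (lintegral_tilt_mul hN hM hcfg hf hT hh hΦ).trans ?_
  rw [← lintegral_indicator hD]
  refine lintegral_congr fun t => ?_
  change ∫⁻ w, D.indicator 1 t * massPartition w p ∂(pkKernel M P₀ t) = _
  rw [lintegral_const_mul _ (measurable_massPartition p), ← massPartitionProb_eq]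
  by_cases ht : t ∈ D
  · rw [indicator_of_mem ht, indicator_of_mem ht, Pi.one_apply, one_mul]
  · rw [indicator_of_notMem ht, indicator_of_notMem ht, zero_mul]

end Sample

/-! ### The explicit conditional partition probability. -/

/-- One term of the exponential series. It provides the integrability required by the Mecke formula.
-/
theorem expNeg_mul_pow_le (x : ℝ≥0∞) (hx : x ≠ ∞) (n : ℕ) : expNeg x * x ^ n ≤ n.factorial := by
  have h0 : 0 ≤ x.toReal := ENNReal.toReal_nonneg
  have h1 : Real.exp (-x.toReal) * x.toReal ^ n ≤ n.factorial := by
    have := Real.pow_div_factorial_le_exp x.toReal h0 n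
    rw [div_le_iff₀ (by positivity)] at this
    rw [Real.exp_neg, inv_mul_le_iff₀ (Real.exp_pos _)]
    exact this
  rw [← ENNReal.ofReal_toReal hx, expNeg_ofReal h0, ← ENNReal.ofReal_pow h0,
    ← ENNReal.ofReal_mul (Real.exp_pos _).le, ← ENNReal.ofReal_natCast]
  exact ENNReal.ofReal_le_ofReal h1

/-- The partition probability is homogeneous of degree `n` in the masses. -/
theorem massPartition_normalizedPoints {n : ℕ} {m : Measure ℝ} (h0 : 0 < pointSum m)
    (h1 : rankedSum m = ENNReal.ofReal (pointSum m))
    (p : Finpartition (Finset.univ : Finset (Fin n))) :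
    massPartition (normalizedPoints m) p =
      (rankedSum m ^ n)⁻¹ * massPartition (rankedPoint m) p := by
  rw [massPartition, massPartition, ← ENNReal.tsum_mul_left]
  refine tsum_congr fun I => ?_
  by_cases hI : I ∈ {I : Fin n → ℕ | tiePartition I = p}
  · rw [indicator_of_mem hI, indicator_of_mem hI]
    simp only [normalizedPoints, ENNReal.ofReal_div_of_pos h0]
    simp only [div_eq_mul_inv]
    rw [Finset.prod_mul_distrib, Finset.prod_const, Finset.card_univ, Fintype.card_fin, h1,
      ENNReal.inv_pow, mul_comm]
  · rw [indicator_of_notMem hI, indicator_of_notMem hI, mul_zero]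

theorem measurable_partitionProbGivenMass {n : ℕ} {ρ : Measure ℝ} [SigmaFinite ρ] {f : ℝ → ℝ≥0∞}
    (hf : Measurable f) (p : Finpartition (Finset.univ : Finset (Fin n))) :
    Measurable (partitionProbGivenMass ρ f p) := by
  have hs : MeasurableSet {q : ℝ × (p.parts → ℝ) | 0 < q.1 - ∑ c, q.2 c} :=
    measurableSet_lt measurable_const (by fun_prop)
  have hg : Measurable fun q : ℝ × (p.parts → ℝ) =>
      f (q.1 - ∑ c, q.2 c) / (ENNReal.ofReal q.1 ^ n * f q.1) *
        ∏ c, ENNReal.ofReal (q.2 c) ^ (c : Finset (Fin n)).card := by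
    refine Measurable.mul (Measurable.div (hf.comp (by fun_prop)) ?_)
      (Finset.measurable_prod _ fun c _ => by fun_prop)
    exact (measurable_fst.ennreal_ofReal.pow_const n).mul (hf.comp measurable_fst)
  exact Measurable.lintegral_prod_right' (hg.indicator hs)

section Density

variable {Ω : Type*} [MeasurableSpace Ω] {P : Measure Ω} [IsProbabilityMeasure P]
  {ρ : Measure ℝ} [SigmaFinite ρ] {M : Ω → Measure ℝ} {f : ℝ → ℝ≥0∞}

/-- The distribution of the sum of the points, integrated over a set where the density is positive
and finite, jointly with the probability that the normalized points generate a partition. -/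
theorem IsPoissonProcess.setLIntegral_massPartitionProb (hM : IsPoissonProcess M ρ P)
    (hρ : ρ (Iic 0) = 0) (hcfg : ∀ᵐ ω ∂P, IsPointConfiguration (M ω)) (hf : Measurable f)
    (hT : P.map (fun ω => pointSum (M ω)) = volume.withDensity f) {n : ℕ}
    (p : Finpartition (Finset.univ : Finset (Fin n))) {B : Set ℝ} (hB : MeasurableSet B)
    (hB0 : ∀ t ∈ B, 0 < t ∧ f t ≠ 0 ∧ f t ≠ ∞) :
    ∫⁻ t in B, f t * massPartitionProb (pkKernel M P t) p =
      ∫⁻ t in B, f t * partitionProbGivenMass ρ f p t := by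
  have hSm : Measurable fun ω => pointSum (M ω) := measurable_pointSum.comp hM.measurable
  have hpos := ae_pointSum_pos hM.measurable hcfg hT
  -- The power `x ^ n` undoes the normalization of the masses. As `B` lies in `(0, ∞)`, the value of
  -- `φ` at `0` is `0`.
  let φ : ℝ≥0∞ → ℝ≥0∞ := fun x => B.indicator 1 x.toReal * (x ^ n)⁻¹
  have hφ : Measurable φ :=
    ((measurable_one.indicator hB).comp ENNReal.measurable_toReal).mul (by fun_prop)
  have hφB : ∀ t, φ (ENNReal.ofReal t) = B.indicator 1 t * (ENNReal.ofReal t ^ n)⁻¹ := fun t => by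
    rcases le_or_gt t 0 with ht | ht
    · have h1 : t ∉ B := fun h => (hB0 t h).1.not_ge ht
      have h2 : (0 : ℝ) ∉ B := fun h => lt_irrefl _ (hB0 0 h).1
      simp only [φ, ENNReal.ofReal_of_nonpos ht, ENNReal.toReal_zero, indicator_of_notMem h1,
        indicator_of_notMem h2, zero_mul]
    · simp only [φ, ENNReal.toReal_ofReal ht.le]
  let a : p.parts → ℝ → ℝ≥0∞ := fun c s => ENNReal.ofReal s ^ (c : Finset (Fin n)).card
  have ha : ∀ c, Measurable (a c) := fun c => by fun_prop
  have hΦ : Measurable fun q : ℝ × (ℕ → ℝ) =>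
      B.indicator (1 : ℝ → ℝ≥0∞) q.1 * massPartition q.2 p :=
    ((measurable_one.indicator hB).comp measurable_fst).mul
      ((measurable_massPartition p).comp measurable_snd)
  have hleft : ∫⁻ t in B, f t * massPartitionProb (pkKernel M P t) p =
      ∫⁻ ω, φ (rankedSum (M ω)) * distinctSum (fun c k => a c (rankedPoint (M ω) k)) ∂P := by
    have h1 : ∫⁻ ω, φ (rankedSum (M ω)) *
        distinctSum (fun c k => a c (rankedPoint (M ω) k)) ∂P =
        ∫⁻ ω, B.indicator 1 (pointSum (M ω)) * massPartition (normalizedPoints (M ω)) p ∂P := by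
      refine lintegral_congr_ae ?_
      filter_upwards [hpos] with ω hω
      rw [massPartition_normalizedPoints hω.1 hω.2, massPartition_eq_distinctSum, hω.2, hφB,
        mul_assoc]
    rw [h1, ← lintegral_indicator hB]
    refine Eq.trans ?_ (lintegral_pointSum_normalizedPoints hM.measurable hf hT hΦ).symm
    refine lintegral_congr fun t => ?_
    change _ = f t * ∫⁻ w, B.indicator 1 t * massPartition w p ∂(pkKernel M P t)
    rw [lintegral_const_mul _ (measurable_massPartition p), ← massPartitionProb_eq]
    by_cases ht : t ∈ B
    · rw [indicator_of_mem ht, indicator_of_mem ht, Pi.one_apply, one_mul]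
    · rw [indicator_of_notMem ht, indicator_of_notMem ht, zero_mul, mul_zero]
  have hfin : ∫⁻ ω, expNeg (rankedSum (M ω)) *
      distinctSum (fun c k => a c (rankedPoint (M ω) k)) ∂P ≠ ∞ := by
    refine ne_top_of_le_ne_top (b := ∫⁻ _, (n.factorial : ℝ≥0∞) ∂P) (by simp)
      (lintegral_mono_ae ?_)
    filter_upwards [hpos] with ω hω
    rw [← massPartition_eq_distinctSum]
    refine le_trans ?_ (expNeg_mul_pow_le (rankedSum (M ω)) (by rw [hω.2]; exact
      ENNReal.ofReal_ne_top) n)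
    gcongr
    exact massPartition_le _ p
  rw [hleft, hM.lintegral_comp_rankedSum_mul_distinctSum hcfg ha
    (hpos.mono fun ω hω => by rw [hω.2]; exact ENNReal.ofReal_lt_top) hfin hφ]
  have hspos : ∀ᵐ s ∂(Measure.pi fun _ : p.parts => ρ), ∀ c, 0 < s c := by
    rw [ae_all_iff]
    intro c
    have : ∀ᵐ x ∂ρ, 0 < x := by
      rw [ae_iff]
      simp only [not_lt]
      exact hρ
    exact (Measure.quasiMeasurePreserving_eval _ c).ae this
  let σ : (p.parts → ℝ) → ℝ := fun s => ∑ c, s c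
  let g : (p.parts → ℝ) → ℝ → ℝ≥0∞ := fun s => (Ioi (σ s)).indicator fun t => f (t - σ s)
  have hgm : Measurable (Function.uncurry g) := by
    have hs : MeasurableSet {q : (p.parts → ℝ) × ℝ | σ q.1 < q.2} :=
      measurableSet_lt (by fun_prop) measurable_snd
    exact (hf.comp (by fun_prop : Measurable fun q : (p.parts → ℝ) × ℝ =>
      q.2 - σ q.1)).indicator hs
  have hinner : ∀ s : p.parts → ℝ, (∀ c, 0 < s c) →
      ∫⁻ ω, φ (rankedSum (M ω) + ∑ c, ENNReal.ofReal (s c)) ∂P =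
        ∫⁻ t, B.indicator 1 t * ((ENNReal.ofReal t ^ n)⁻¹ * g s t) := by
    intro s hs
    have hφs : Measurable fun u => φ (ENNReal.ofReal (u + σ s)) := by
      exact hφ.comp (by fun_prop)
    have h1 : ∫⁻ ω, φ (rankedSum (M ω) + ∑ c, ENNReal.ofReal (s c)) ∂P =
        ∫⁻ ω, φ (ENNReal.ofReal (pointSum (M ω) + σ s)) ∂P := by
      refine lintegral_congr_ae ?_
      filter_upwards [hpos] with ω hω
      rw [hω.2, ENNReal.ofReal_add hω.1.le (Finset.sum_nonneg fun c _ => (hs c).le),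
        ENNReal.ofReal_sum_of_nonneg fun c _ => (hs c).le]
    rw [h1, ← lintegral_map hφs hSm, hT, lintegral_withDensity_eq_lintegral_mul _ hf hφs,
      -- Translation by the sum of the extracted points turns the density `f` into `t ↦ f (t - σ
      -- s)`; the indicator in `g` is harmless because `f` vanishes almost everywhere on `(-∞, 0]`.
      ← lintegral_sub_right_eq_self _ (σ s)]
    have h2 := density_eq_zero_of_nonpos hM.measurable hcfg hf hT
    have h3 := (measurePreserving_sub_right volume (σ s)).quasiMeasurePreserving.ae h2
    refine lintegral_congr_ae ?_
    filter_upwards [h3] with t ht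
    simp only [Pi.mul_apply, sub_add_cancel, hφB, g]
    by_cases h4 : σ s < t
    · rw [indicator_of_mem (show t ∈ Ioi (σ s) from h4)]
      ring
    · rw [indicator_of_notMem (show t ∉ Ioi (σ s) from h4), ht (by linarith)]
      simp
  have hright : ∀ t, (∫⁻ s, (∏ c, a c (s c)) * (B.indicator 1 t *
      ((ENNReal.ofReal t ^ n)⁻¹ * g s t)) ∂(Measure.pi fun _ : p.parts => ρ)) =
      B.indicator (fun t => f t * partitionProbGivenMass ρ f p t) t := by
    intro t
    by_cases ht : t ∈ B
    -- The factor `f t` cancels the one in the denominator, which requires `f t` to be neither `0`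
    -- nor `∞`.
    · obtain ⟨-, hf0, hf1⟩ := hB0 t ht
      rw [indicator_of_mem ht, indicator_of_mem ht, partitionProbGivenMass,
        ← lintegral_const_mul' _ _ hf1]
      refine lintegral_congr fun s => ?_
      by_cases h4 : σ s < t
      · rw [indicator_of_mem (by exact sub_pos.2 h4), div_eq_mul_inv,
          ENNReal.mul_inv (Or.inr hf1) (Or.inr hf0)]
        simp only [g, indicator_of_mem (show t ∈ Ioi (σ s) from h4), Pi.one_apply, one_mul]
        calc _ = (f t * (f t)⁻¹) * ((∏ c, a c (s c)) * ((ENNReal.ofReal t ^ n)⁻¹ * f (t - σ s))) := by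
              rw [ENNReal.mul_inv_cancel hf0 hf1, one_mul]
          _ = _ := by simp only [a, σ]; ring
      · rw [indicator_of_notMem (by exact fun h => h4 (sub_pos.1 h))]
        simp only [g, indicator_of_notMem (show t ∉ Ioi (σ s) from h4), mul_zero]
    · rw [indicator_of_notMem ht, indicator_of_notMem ht]
      simp
  have hαm : Measurable fun s : p.parts → ℝ => ∏ c, a c (s c) :=
    Finset.measurable_prod _ fun c _ => (ha c).comp (measurable_pi_apply c)
  have hgs : ∀ s, Measurable (g s) := fun s => hgm.comp measurable_prodMk_left
  have hBm : Measurable (B.indicator (1 : ℝ → ℝ≥0∞)) := measurable_one.indicator hB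
  rw [lintegral_congr_ae (hspos.mono fun s hs => congrArg ((∏ c, a c (s c)) * ·) (hinner s hs)),
    ← lintegral_indicator hB]
  have hc : ∀ s : p.parts → ℝ, (∏ c, a c (s c)) * ∫⁻ t, B.indicator 1 t *
      ((ENNReal.ofReal t ^ n)⁻¹ * g s t) = ∫⁻ t, (∏ c, a c (s c)) * (B.indicator 1 t *
      ((ENNReal.ofReal t ^ n)⁻¹ * g s t)) := fun s => (lintegral_const_mul _ (hBm.mul
    (((measurable_id.ennreal_ofReal.pow_const n).inv).mul (hgs s)))).symm
  simp_rw [← hright, hc]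
  refine lintegral_lintegral_swap (Measurable.aemeasurable ?_)
  exact (hαm.comp measurable_fst).mul ((hBm.comp measurable_snd).mul
    (((measurable_snd.ennreal_ofReal.pow_const n).inv).mul hgm))

/-- The probability that masses with the Poisson–Kingman law given the sum generate a partition. -/
theorem IsPoissonProcess.partitionProbGivenMass_ae_eq (hM : IsPoissonProcess M ρ P)
    (hρ : ρ (Iic 0) = 0) (hcfg : ∀ᵐ ω ∂P, IsPointConfiguration (M ω)) (hf : Measurable f)
    (hT : P.map (fun ω => pointSum (M ω)) = volume.withDensity f) {n : ℕ}
    (p : Finpartition (Finset.univ : Finset (Fin n))) :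
    ∀ᵐ t, f t ≠ 0 → partitionProbGivenMass ρ f p t = massPartitionProb (pkKernel M P t) p := by
  -- On this set `f` can be cancelled. Almost every `t` with `f t ≠ 0` belongs to it, since `f` is
  -- integrable and vanishes almost everywhere on `(-∞, 0]`.
  let G : Set ℝ := {t | 0 < t ∧ f t ≠ 0 ∧ f t ≠ ∞}
  have hG : MeasurableSet G := measurableSet_Ioi.inter
    ((hf (measurableSet_singleton 0).compl).inter (hf (measurableSet_singleton ∞).compl))
  have hk : Measurable fun t => massPartitionProb (pkKernel M P t) p := by
    simp_rw [massPartitionProb_eq]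
    exact (measurable_massPartition p).lintegral_kernel
  have h1 : (fun t => f t * partitionProbGivenMass ρ f p t) =ᵐ[volume.restrict G]
      fun t => f t * massPartitionProb (pkKernel M P t) p := by
    refine ae_eq_of_forall_setLIntegral_eq_of_sigmaFinite
      (hf.mul (measurable_partitionProbGivenMass hf p)) (hf.mul hk) fun B hB _ => ?_
    rw [Measure.restrict_restrict hB]
    exact (hM.setLIntegral_massPartitionProb hρ hcfg hf hT p (hB.inter hG) fun t ht => ht.2).symm
  have hfi : ∫⁻ t, f t ≠ ∞ := by
    have : IsProbabilityMeasure (P.map fun ω => pointSum (M ω)) :=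
      Measure.isProbabilityMeasure_map (measurable_pointSum.comp hM.measurable).aemeasurable
    rw [← setLIntegral_univ, ← withDensity_apply _ MeasurableSet.univ, ← hT]
    exact measure_ne_top _ _
  filter_upwards [(ae_restrict_iff' hG).1 h1, ae_lt_top hf hfi,
    density_eq_zero_of_nonpos hM.measurable hcfg hf hT] with t ht htop hneg h0
  have htG : t ∈ G := ⟨lt_of_not_ge fun h => h0 (hneg h), h0, htop.ne⟩
  exact (ENNReal.mul_right_inj h0 htop.ne).1 (ht htG)

end Density

/-! ### Laws of the tilted mass and of the partition, and the conclusion. -/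

theorem measurable_tiePartition {X : Type*} [MeasurableSpace X] [MeasurableEq X] {n : ℕ} :
    Measurable (tiePartition : (Fin n → X) → Finpartition (Finset.univ : Finset (Fin n))) :=
  measurable_to_countable' measurableSet_tiePartition_eq

section Statement

variable {X Ω Ω₀ Ω' : Type*} [MeasurableSpace X] [MeasurableSpace Ω]
  [MeasurableSpace Ω₀] [MeasurableSpace Ω']
  {P : Measure Ω} [IsProbabilityMeasure P] {P₀ : Measure Ω₀} [IsProbabilityMeasure P₀]
  {P' : Measure Ω'}
  {η : Measure X} [IsProbabilityMeasure η] {ρ : Measure ℝ} [SigmaFinite ρ]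
  {N : Ω → Measure (X × ℝ)} {M : Ω₀ → Measure ℝ} {f : ℝ → ℝ≥0∞} {h : ℝ → ℝ}
  {n : ℕ} {μ : Ω' → Measure X} {Y : Fin n → Ω' → X}

/-- The distribution of the total mass of the tilted completely random measure. -/
theorem map_mass_eq_withDensity_tiltedDensity (hN : IsPoissonProcess N (η.prod ρ) P)
    (hM : IsPoissonProcess M ρ P₀) (hcfg : ∀ᵐ ω ∂P₀, IsPointConfiguration (M ω))
    (hf : Measurable f)
    (hT : P₀.map (fun ω => pointSum (M ω)) = volume.withDensity f) (hh : Measurable h)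
    (hμ : Measurable μ) (hlaw : P'.map μ = tiltedLaw h (P.map fun ω => crm (N ω))) :
    P'.map (fun ω => mass (μ ω)) = volume.withDensity (tiltedDensity h f) := by
  ext D hD
  have hI : Measurable (D.indicator (1 : ℝ → ℝ≥0∞)) := measurable_one.indicator hD
  have h1 := lintegral_tilt_mul hN hM hcfg hf hT hh (Φ := fun q => D.indicator 1 q.1)
    (hI.comp measurable_fst)
  simp only [lintegral_const, measure_univ, mul_one] at h1
  rw [← lintegral_indicator_one hD, ← lintegral_indicator_one hD, ← h1,
    lintegral_map hI (show Measurable fun ω => mass (μ ω) from measurable_mass.comp hμ)]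
  refine (lintegral_map (hI.comp measurable_mass) hμ).symm.trans ?_
  rw [hlaw]
  refine (lintegral_tiltedLaw hN hM hcfg hT hh (hI.comp measurable_mass)).trans ?_
  congr 1
  refine lintegral_congr_ae ?_
  filter_upwards [ae_pointSum_pos hM.measurable hcfg hT] with ω hω
  have hmass : ∀ z : ℕ → X, mass (atomicMeasure (rankedPoint (M ω)) z) = pointSum (M ω) :=
    fun z => by
      rw [mass, atomicMeasure_univ]
      change (rankedSum (M ω)).toReal = _
      rw [hω.2, ENNReal.toReal_ofReal hω.1.le]
  simp only [Function.comp_apply, hmass, lintegral_const, measure_univ, mul_one]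

/-- The conditional law of the partition generated by the sample given the total mass. -/
theorem condDistrib_tiePartition_ae_eq [IsProbabilityMeasure P'] [MeasurableEq X] (hN : IsPoissonProcess N (η.prod ρ) P)
    (hM : IsPoissonProcess M ρ P₀) (hcfg : ∀ᵐ ω ∂P₀, IsPointConfiguration (M ω))
    (hf : Measurable f)
    (hT : P₀.map (fun ω => pointSum (M ω)) = volume.withDensity f) (hh : Measurable h)
    (hη : ∀ x, η {x} = 0)
    (hY : IsNormalizedSample (tiltedLaw h (P.map fun ω => crm (N ω))) μ Y P')
    (p : Finpartition (Finset.univ : Finset (Fin n))) :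
    (fun t => condDistrib (fun ω => tiePartition fun i => Y i ω) (fun ω => mass (μ ω)) P' t {p})
      =ᵐ[P'.map fun ω => mass (μ ω)] fun t => massPartitionProb (pkKernel M P₀ t) p := by
  have hm : Measurable fun ω => mass (μ ω) := measurable_mass.comp hY.measurable_measure
  have ht : Measurable fun ω => tiePartition fun i => Y i ω :=
    measurable_tiePartition.comp (measurable_pi_lambda _ hY.measurable_sample)
  have hk : Measurable fun t => massPartitionProb (pkKernel M P₀ t) p := by
    simp_rw [massPartitionProb_eq]
    exact (measurable_massPartition p).lintegral_kernel
  have hc : Measurable fun t => condDistrib (fun ω => tiePartition fun i => Y i ω)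
      (fun ω => mass (μ ω)) P' t {p} := Kernel.measurable_coe _ (measurableSet_singleton p)
  have : IsProbabilityMeasure (P'.map fun ω => mass (μ ω)) :=
    Measure.isProbabilityMeasure_map hm.aemeasurable
  refine ae_eq_of_forall_setLIntegral_eq_of_sigmaFinite hc hk fun D hD _ => ?_
  -- Both versions have the same integral over every `D`: the joint probability that the mass lies
  -- in `D` and the partition is `p`.
  rw [setLIntegral_map hD hc hm,
    setLIntegral_preimage_condDistrib hm ht.aemeasurable (measurableSet_singleton p) hD,
    map_mass_eq_withDensity_tiltedDensity hN hM hcfg hf hT hh hY.measurable_measure hY.law]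
  exact measure_mass_tiePartition hN hM hcfg hf hT hh hη hY hD p

end Statement

theorem mainTheorem5
    {X : Type*} [MetricSpace X] [CompleteSpace X] [SecondCountableTopology X]
    [MeasurableSpace X] [BorelSpace X]
    -- the homogeneous intensity `η(dx) ρ(ds)`
    (η : Measure X) [IsProbabilityMeasure η] (ρ : Measure ℝ) [SigmaFinite ρ]
    (hν : IsCRMIntensity (η.prod ρ))
    -- the Poisson process behind the completely random measure
    {Ω : Type*} [MeasurableSpace Ω] (P : Measure Ω) [IsProbabilityMeasure P]
    (N : Ω → Measure (X × ℝ)) (hN : IsPoissonProcess N (η.prod ρ) P)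
    -- the density of the total mass of the completely random measure
    (f : ℝ → ℝ≥0∞) (hf : Measurable f)
    (hT : P.map (fun ω => mass (crm (N ω))) = volume.withDensity f)
    -- the tilt
    (h : ℝ → ℝ) (hmeas : Measurable h) (hpos : ∀ x, 0 < x → 0 < h x)
    (hfin : ∫⁻ ω, ENNReal.ofReal (h (mass (crm (N ω)))) ∂P < ∞)
    -- the tilted completely random measure and a sample from its normalization
    {Ω' : Type*} [MeasurableSpace Ω'] (P' : Measure Ω') [IsProbabilityMeasure P']
    (μ : Ω' → Measure X) (n : ℕ) (Y : Fin n → Ω' → X)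
    (hY : IsNormalizedSample (tiltedLaw h (P.map fun ω => crm (N ω))) μ Y P')
    -- a Poisson process on `(0, ∞)` with intensity `ρ`, which defines the Poisson-Kingman laws
    {Ω₀ : Type*} [MeasurableSpace Ω₀] (P₀ : Measure Ω₀) [IsProbabilityMeasure P₀]
    (M : Ω₀ → Measure ℝ) (hM : IsPoissonProcess M ρ P₀) :
    -- the tilted total mass has the tilted density
    P'.map (fun ω => mass (μ ω)) = volume.withDensity (tiltedDensity h f) ∧
    -- the conditional law of the partition given the tilted total mass `t`
    (∀ᵐ t ∂(P'.map fun ω => mass (μ ω)),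
      ∀ p : Finpartition (Finset.univ : Finset (Fin n)),
        condDistrib (fun ω => tiePartition fun i => Y i ω) (fun ω => mass (μ ω)) P' t {p} =
            partitionProbGivenMass ρ f p t ∧
          partitionProbGivenMass ρ f p t = massPartitionProb (pkKernel M P₀ t) p) ∧
    -- the partition is a Poisson-Kingman partition `(ρ, γ)` with `γ` the tilted density
    (∀ p : Finpartition (Finset.univ : Finset (Fin n)),
      P' {ω | (tiePartition fun i => Y i ω) = p} =
        massPartitionProb
          ((volume.withDensity (tiltedDensity h f)).bind (pkKernel M P₀)) p) ∧
    -- the normalized tilted completely random measure is the Poisson-Kingman process `(ρ, γ)`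
    P'.map (fun ω => normalized (μ ω)) =
      speciesLaw ((volume.withDensity (tiltedDensity h f)).bind (pkKernel M P₀)) η := by

  have hρ := hN.measure_univ_eq_top hT
  have hcfg := hM.ae_isPointConfiguration hν.measure_Iic hρ fun x hx => hν.measure_Ioi_lt_top hx
  have hη := hν.measure_singleton (by rw [hρ]; exact ENNReal.top_ne_zero)
  have hT₀ := (hN.map_pointSum hM hcfg).trans hT
  have hmap := map_mass_eq_withDensity_tiltedDensity hN hM hcfg hf hT₀ hmeas
    hY.measurable_measure hY.law
  refine ⟨hmap, ?_, fun p => ?_, ?_⟩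
  · rw [ae_all_iff]
    intro p
    have h1 := hM.partitionProbGivenMass_ae_eq hν.measure_Iic hcfg hf hT₀ p
    have h2 : ∀ᵐ t ∂(P'.map fun ω => mass (μ ω)),
        partitionProbGivenMass ρ f p t = massPartitionProb (pkKernel M P₀ t) p := by
      rw [hmap, ae_withDensity_iff (measurable_tiltedDensity hmeas hf)]
      filter_upwards [h1] with t ht h0
      -- Where `f` vanishes so does the tilted density, so the exceptional set where nothing is
      -- known has measure zero under the tilted law.
      refine ht fun h => h0 ?_
      rw [tiltedDensity, h, mul_zero, ENNReal.zero_div]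
    filter_upwards [condDistrib_tiePartition_ae_eq hN hM hcfg hf hT₀ hmeas hη hY p, h2]
      with t ht1 ht2
    exact ⟨ht1.trans ht2.symm, ht2⟩
  · have h1 := measure_mass_tiePartition hN hM hcfg hf hT₀ hmeas hη hY MeasurableSet.univ p
    simp only [mem_univ, true_and, setLIntegral_univ] at h1
    rw [h1, massPartitionProb_eq, Measure.lintegral_bind (pkKernel M P₀).measurable.aemeasurable
      (measurable_massPartition p).aemeasurable]
    simp_rw [massPartitionProb_eq]
  · rw [← map_normalized_tiltedLaw hN hM hcfg hf hT₀ hmeas, ← hY.law,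
      Measure.map_map measurable_normalized hY.measurable_measure]
    rfl
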